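/- **Theorem (determinizability of one-counter automata with counter observability).** *Automata.* Let $\mathsf{Op}=\{\mathsf{inc},\mathsf{dec}\}$. A one-counter automaton (OCA) over a nonempty finite alphabet $\Sigma$ (disjoint from $\mathsf{Op}$) is a tuple $\mathcal A=(Q,\Sigma,\iota,F,m,\Delta)$ with a finite set $Q$ of states, $\iota\in Q$, $F\subseteq Q$, a threshold $m\in\mathbb N$ and $\Delta\subseteq Q\times\{0,\dots,m\}\times(\Sigma\cup\mathsf{Op})\times Q$. Its size is $|\mathcal A|=|Q|+|\Sigma|+m+|\Delta|$. A configuration is a pair $(q,x)\in Q\times\mathbb N$. There is a step from $(q,x)$ to $(q',x')$ with label $\mathsf{inc}$ if $x'=x+1$ and $(q,\min\{x,m\},\mathsf{inc},q')\in\Delta$; with label $\mathsf{dec}$ if $x\ge 1$, $x'=x-1$ and $(q,\min\{x,m\},\mathsf{dec},q')\in\Delta$; and with label $(a,x)$, where $a\in\Sigma$, if $x'=x$ and $(q,\min\{x,m\},a,q')\in\Delta$. An accepting run is a finite sequence of steps from $(\iota,0)$ to a configuration with state in $F$; its trace is its sequence of labels. The visibly language $L_{vis}(\mathcal A)\subseteq(\Sigma\cup\mathsf{Op})^*$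 consists of the traces of accepting runs with each $(a,x)$ replaced by $a$; the counter-observability language $L_{obs}(\mathcal A)\subseteq(\Sigma\times\mathbb N)^*$ consists of the traces of accepting runs with all labels from $\mathsf{Op}$ deleted. $\mathcal A$ is deterministic if for all $(q,k,\sigma)\in Q\times\{0,\dots,m\}\times(\Sigma\cup\mathsf{Op})$ there is exactly one $q'$ with $(q,k,\sigma,q')\in\Delta$. *Encodings.* For $w=(a_1,x_1)\cdots(a_n,x_n)\in(\Sigma\times\mathbb N)^*$ and $x_0=0$ let $\mathsf{enc}(w)=u_1a_1u_2a_2\cdots u_na_n$, where $u_i=\mathsf{inc}^{\,x_i-x_{i-1}}$ if $x_i\ge x_{i-1}$ and $u_i=\mathsf{dec}^{\,x_{i-1}-x_i}$ otherwise. Let $\mathsf{Enc}_\Sigma=\{\mathsf{enc}(w)\mid w\in(\Sigma\times\mathbb N)^*\}$. *Claim.* There are polynomials $p,r$ and an algorithm that, given an OCA $\mathcal A$ over any alphabet $\Sigma$, computes in at most $2^{p(|\mathcal A|)}$ steps an OCA $\mathcal A'$ over $\Sigma$ such that 1. $\mathcal A'$ is deterministic, 2. the threshold of $\mathcal A'$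 is at most $r(|\mathcal A|)$, 3. $L_{obs}(\mathcal A')=L_{obs}(\mathcal A)$, and 4. $L_{vis}(\mathcal A')\subseteq\mathsf{Enc}_\Sigma$. (A deterministic OCA with property 4 is called deterministic with respect to the observability semantics.) Here an algorithm is a program of a unit-cost random access machine with addition and truncated subtraction, which is polynomially equivalent to Turing machines. OCAs are given and returned as lists of natural numbers, with respect to a numbering of the states and of the letters: number of states, number of letters, threshold, number of the initial state, and the $0$-$1$-tables of $F$ and $\Delta$. -/

import Mathlib

/-! ## One-counter automata -/

/-- The two counter operations: increment and decrement by one. -/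
inductive CounterOp where
  | inc
  | dec
  deriving DecidableEq

/-- A one-counter automaton with state set `Q` and alphabet `α` (both are required to be finite where
the automaton is used). A transition `(q, k, σ, q')` carries a counter test `k ∈ {0, …, m}` and a
label `σ` that is either a letter or a counter operation. -/
structure OCA (Q α : Type*) where
  init : Q
  final : Finset Q
  threshold : ℕ
  trans : Finset (Q × Fin (threshold + 1) × (α ⊕ CounterOp) × Q)

namespace OCA

variable {Q α : Type*}

/-- `|Q| + |Σ| + m + |Δ|`. -/
def size [Fintype Q] [Fintype α] (A : OCA Q α) : ℕ :=
  Fintype.card Q + Fintype.card α + A.threshold + A.trans.card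

/-- The only counter test that is passed by the counter value `x`, that is `min x m`. -/
def test (A : OCA Q α) (x : ℕ) : Fin (A.threshold + 1) :=
  ⟨min x A.threshold, Nat.lt_succ_of_le (min_le_right _ _)⟩

/-- The global transition relation between configurations (state, counter value). -/
inductive Step (A : OCA Q α) : Q × ℕ → (α × ℕ) ⊕ CounterOp → Q × ℕ → Prop
  | inc {q q' : Q} {x : ℕ} (h : (q, A.test x, Sum.inr CounterOp.inc, q') ∈ A.trans) :
      Step A (q, x) (Sum.inr CounterOp.inc) (q', x + 1)
  | dec {q q' : Q} {x : ℕ} (h : (q, A.test (x + 1), Sum.inr CounterOp.dec, q') ∈ A.trans) :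
      Step A (q, x + 1) (Sum.inr CounterOp.dec) (q', x)
  | letter {q q' : Q} {x : ℕ} {a : α} (h : (q, A.test x, Sum.inl a, q') ∈ A.trans) :
      Step A (q, x) (Sum.inl (a, x)) (q', x)

/-- `A.PartialRun c τ c'`: there is a partial run from `c` to `c'` with trace `τ`. -/
inductive PartialRun (A : OCA Q α) : Q × ℕ → List ((α × ℕ) ⊕ CounterOp) → Q × ℕ → Prop
  | nil (c : Q × ℕ) : PartialRun A c [] c
  | cons {c c' c'' : Q × ℕ} {t : (α × ℕ) ⊕ CounterOp} {ts : List ((α × ℕ) ⊕ CounterOp)}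
      (h : A.Step c t c') (hs : PartialRun A c' ts c'') : PartialRun A c (t :: ts) c''

/-- `τ` is the trace of an accepting run, starting in the initial state with counter value `0`. -/
def AcceptsTrace (A : OCA Q α) (τ : List ((α × ℕ) ⊕ CounterOp)) : Prop :=
  ∃ q x, A.PartialRun (A.init, 0) τ (q, x) ∧ q ∈ A.final

end OCA

/-- The visibly projection of a trace: the counter values are dropped, operations are kept. -/
def visTrace {α : Type*} (τ : List ((α × ℕ) ⊕ CounterOp)) : List (α ⊕ CounterOp) :=
  τ.map (Sum.map Prod.fst id)

/-- The observability projection of a trace: the operations are dropped, letters are kept together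
with the counter values. -/
def obsTrace {α : Type*} (τ : List ((α × ℕ) ⊕ CounterOp)) : List (α × ℕ) :=
  τ.filterMap Sum.getLeft?

namespace OCA

variable {Q α : Type*}

/-- The visibly language. -/
def Lvis (A : OCA Q α) : Language (α ⊕ CounterOp) :=
  {w | ∃ τ, A.AcceptsTrace τ ∧ visTrace τ = w}

/-- The language with counter observability. -/
def Lobs (A : OCA Q α) : Language (α × ℕ) :=
  {w | ∃ τ, A.AcceptsTrace τ ∧ obsTrace τ = w}

/-- Deterministic OCA: exactly one successor state for every state, test and label. -/
def IsDeterministic (A : OCA Q α) : Prop :=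
  ∀ (q : Q) (k : Fin (A.threshold + 1)) (σ : α ⊕ CounterOp), ∃! q', (q, k, σ, q') ∈ A.trans

end OCA

/-! ## Encoding of words over letters and counter values -/

/-- The word `sign(y - x) ^ |y - x|`. -/
def opsBetween (α : Type*) (x y : ℕ) : List (α ⊕ CounterOp) :=
  List.replicate ((y : ℤ) - (x : ℤ)).natAbs
    (Sum.inr (if 0 ≤ (y : ℤ) - (x : ℤ) then CounterOp.inc else CounterOp.dec))

/-- Encoding of a word when the counter value before its first letter is `x`. -/
def encFrom {α : Type*} (x : ℕ) : List (α × ℕ) → List (α ⊕ CounterOp)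
  | [] => []
  | (a, y) :: w => opsBetween α x y ++ Sum.inl a :: encFrom y w

/-- `enc((a₁,x₁)…(aₙ,xₙ)) = inc^x₁ a₁ sign(x₂-x₁)^|x₂-x₁| a₂ … sign(xₙ-xₙ₋₁)^|xₙ-xₙ₋₁| aₙ`. -/
def enc {α : Type*} (w : List (α × ℕ)) : List (α ⊕ CounterOp) :=
  encFrom 0 w

/-- The set of valid encodings. -/
def Encs (α : Type*) : Language (α ⊕ CounterOp) :=
  Set.range enc

/-! ## Random access machines

The model of computation: random access machines in structured form, with a read-only input
array, a memory of natural numbers that is initially `0` everywhere, and a write-only output.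
Arithmetic is limited to addition and truncated subtraction, so that the step count (number of
elementary operations) is polynomially related to the running time of Turing machines. -/

namespace RAM

/-- Expressions; `mem e` and `input e` are the memory cell and the input cell with address `e`. -/
inductive Expr where
  | const (k : ℕ)
  | mem (e : Expr)
  | input (e : Expr)
  | add (e f : Expr)
  | sub (e f : Expr)

/-- Value of an expression; cells beyond the end of the input contain `0`. -/
def Expr.eval (inp : List ℕ) (M : ℕ → ℕ) : Expr → ℕ
  | const k => k
  | mem e => M (e.eval inp M)
  | input e => inp.getD (e.eval inp M) 0
  | add e f => e.eval inp M + f.eval inp M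
  | sub e f => e.eval inp M - f.eval inp M

/-- Number of elementary operations in the evaluation of an expression. -/
def Expr.cost : Expr → ℕ
  | const _ => 1
  | mem e => e.cost + 1
  | input e => e.cost + 1
  | add e f => e.cost + f.cost + 1
  | sub e f => e.cost + f.cost + 1

/-- Programs; a condition holds if its value is not `0`. -/
inductive Prog where
  | skip
  | assign (addr val : Expr)
  | write (val : Expr)
  | seq (p q : Prog)
  | cond (c : Expr) (p q : Prog)
  | loop (c : Expr) (p : Prog)

/-- The memory and the output that has been written so far. -/
structure State where
  mem : ℕ → ℕ
  out : List ℕ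

/-- `Exec inp p s t s'`: on input `inp`, the program `p` started in state `s` halts in state `s'`
after exactly `t` steps. -/
inductive Exec (inp : List ℕ) : Prog → State → ℕ → State → Prop
  | skip (s : State) : Exec inp Prog.skip s 1 s
  | assign (addr val : Expr) (s : State) :
      Exec inp (Prog.assign addr val) s (addr.cost + val.cost + 1)
        ⟨Function.update s.mem (addr.eval inp s.mem) (val.eval inp s.mem), s.out⟩
  | write (val : Expr) (s : State) :
      Exec inp (Prog.write val) s (val.cost + 1) ⟨s.mem, s.out ++ [val.eval inp s.mem]⟩
  | seq {p q : Prog} {s s' s'' : State} {t t' : ℕ}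
      (hp : Exec inp p s t s') (hq : Exec inp q s' t' s'') : Exec inp (Prog.seq p q) s (t + t') s''
  | cond_true {c : Expr} {p q : Prog} {s s' : State} {t : ℕ}
      (hc : c.eval inp s.mem ≠ 0) (hp : Exec inp p s t s') :
      Exec inp (Prog.cond c p q) s (c.cost + t) s'
  | cond_false {c : Expr} {p q : Prog} {s s' : State} {t : ℕ}
      (hc : c.eval inp s.mem = 0) (hq : Exec inp q s t s') :
      Exec inp (Prog.cond c p q) s (c.cost + t) s'
  | loop_true {c : Expr} {p : Prog} {s s' s'' : State} {t t' : ℕ}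
      (hc : c.eval inp s.mem ≠ 0) (hp : Exec inp p s t s')
      (hl : Exec inp (Prog.loop c p) s' t' s'') :
      Exec inp (Prog.loop c p) s (c.cost + t + t') s''
  | loop_false {c : Expr} {p : Prog} {s : State} (hc : c.eval inp s.mem = 0) :
      Exec inp (Prog.loop c p) s c.cost s

/-- On input `inp`, the program halts within `T` steps, and its output is `res`. -/
def Prog.OutputsWithin (p : Prog) (inp res : List ℕ) (T : ℕ) : Prop :=
  ∃ (t : ℕ) (M : ℕ → ℕ), t ≤ T ∧ Exec inp p ⟨fun _ => 0, []⟩ t ⟨M, res⟩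

end RAM

/-! ## Automata as inputs and outputs of programs -/

/-- The labels, in the order of a numbering of the alphabet, followed by the two operations. -/
def labelList {α : Type*} {s : ℕ} (eα : α ≃ Fin s) : List (α ⊕ CounterOp) :=
  (List.finRange s).map (fun a => Sum.inl (eα.symm a)) ++
    [Sum.inr CounterOp.inc, Sum.inr CounterOp.dec]

open Classical in
/-- The automaton as a list of natural numbers, given numberings of its states and letters: number
of states, number of letters, threshold, number of the initial state, then the `0`-`1`-tables of
the final states and of the transitions `(p, k, σ, q)`, in lexicographic order. -/
noncomputable def OCA.encode {Q α : Type*} {n s : ℕ} (eQ : Q ≃ Fin n) (eα : α ≃ Fin s)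
    (A : OCA Q α) : List ℕ :=
  [n, s, A.threshold, (eQ A.init : ℕ)] ++
    (List.finRange n).map (fun q => if eQ.symm q ∈ A.final then 1 else 0) ++
    (List.finRange n).flatMap fun p =>
      (List.finRange (A.threshold + 1)).flatMap fun k =>
        (labelList eα).flatMap fun σ =>
          (List.finRange n).map fun q =>
            if (eQ.symm p, k, σ, eQ.symm q) ∈ A.trans then 1 else 0

/-! The nondeterminism that has to be controlled lies in the silent runs, that is, the sequences of
counter operations between two letters. A silent run from counter value `x` to `y` factors into
monotone steps from `x` to `y`, interleaved with loops that return to the value at which they start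
(`ascend_or_descend_of_silent`). A subset construction may therefore move the counter monotonically
between two observed values, provided that it applies the loop relation at every value on the way
(`silent_up_iff`, `silent_dn_iff`). A mode in the state forbids a change of direction between two
letters, and acceptance is decided directly after a letter (or at the start). So every accepted
visible word is an encoding. Acceptance can be decided so early because an absorbing state, entered
from the final states, turns the accepting silent runs into loops as well.

The difficulty is that the loop relation depends on the counter value, of which only the minimum
with the threshold can be tested. Let `v` be the number of states, including the absorbing one. The
loops that stay above `x` are exhausted at a fixed height (`above_stable`) and are constant for `x ≥
m` (`peak_const`). Loops that also go below `x` satisfy a linear recurrence in `x` over pairs of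
states. Its solution is governed by the lengths of walks in a graph with `v * v` vertices, and these
are eventually periodic (`Walk.periodic`): on a long walk there is a short cycle, the rest can be
shortened modulo its length, and the cycle fills the gap. Hence the loop relation has the polynomial
preperiod `m + 2 * v ^ 4` and the period `(v * v)!` (`loops_periodic`). The new threshold covers the
preperiod, and the residue modulo the period, which is only exponential, is kept in the state
together with the mode and the set of states.

For the running time, functions computable in exponential time are shown to be closed under
composition and under primitive recursion with exponentially bounded values (`Does.loop`). Sets and
relations on polynomially many states become numbers with polynomially many bits, and the
recurrences for the loops become recurrences for these numbers. -/

namespace RAM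

/-! ### Programs for functions on a context -/

open Polynomial

/-- A family of evaluation contexts, indexed by `Γ`: every context has an input, a size and some
numbers that are known in the sense that they are found in fixed memory cells. -/
structure Ctx where
  Γ : Type
  inp : Γ → List ℕ
  sz : Γ → ℕ
  known : Set (Γ → ℕ)
  inp_le : ∀ γ i, (inp γ).getD i 0 ≤ sz γ

namespace Ctx

/-- Adds the function `a` to the known ones. -/
def learn (C : Ctx) (a : C.Γ → ℕ) : Ctx :=
  { C with known := insert a C.known }

/-- Adds an index that ranges over the numbers below `n`. -/
def push (C : Ctx) (n : C.Γ → ℕ) : Ctx where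
  Γ := (γ : C.Γ) × Fin (n γ)
  inp x := C.inp x.1
  sz x := C.sz x.1
  known := insert (fun x => (x.2 : ℕ)) ((fun e x => e x.1) '' C.known)
  inp_le x := C.inp_le x.1

/-- Bounds are stated in the size alone, which `push` does not change. A bound for the body of a
loop is thus uniform over all rounds. -/
def PolyBounded (C : Ctx) (f : C.Γ → ℕ) : Prop :=
  ∃ p : ℕ[X], ∀ γ, f γ ≤ p.eval (C.sz γ)

def ExpBounded (C : Ctx) (f : C.Γ → ℕ) : Prop :=
  ∃ p : ℕ[X], ∀ γ, f γ ≤ 2 ^ p.eval (C.sz γ)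

/-- In exponential time, `f γ` can be stored in any cell `r` above the known cells, while `l γ` is
written and no cell below `r` is changed. -/
def Does (C : Ctx) (f : C.Γ → ℕ) (l : C.Γ → List ℕ) : Prop :=
  C.ExpBounded f ∧ ∀ (loc : (C.Γ → ℕ) → ℕ) (r : ℕ), (∀ e ∈ C.known, loc e < r) →
    ∃ (P : Prog) (T : C.Γ → ℕ), C.ExpBounded T ∧
      ∀ γ M o, (∀ e ∈ C.known, M (loc e) = e γ) → ∃ t M',
        Exec (C.inp γ) P ⟨M, o⟩ t ⟨M', o ++ l γ⟩ ∧ t ≤ T γ ∧ M' r = f γ ∧ ∀ i < r, M' i = M i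

/-- `f` is computable in exponential time. -/
def Comp (C : Ctx) (f : C.Γ → ℕ) : Prop :=
  C.Does f fun _ => []

open Classical in
/-- `p` is decidable in exponential time. -/
def Dec (C : Ctx) (p : C.Γ → Prop) : Prop :=
  C.Comp fun γ => if p γ then 1 else 0

/-- The list `l` can be written in exponential time. -/
def Writes (C : Ctx) (l : C.Γ → List ℕ) : Prop :=
  C.Does (fun _ => 0) l

variable {C : Ctx}

/-! ### Bounds -/

theorem PolyBounded.mono {f g : C.Γ → ℕ} (hg : C.PolyBounded g) (h : ∀ γ, f γ ≤ g γ) :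
    C.PolyBounded f := by
  obtain ⟨p, hp⟩ := hg
  exact ⟨p, fun γ => (h γ).trans (hp γ)⟩

theorem PolyBounded.const (k : ℕ) : C.PolyBounded fun _ => k :=
  ⟨Polynomial.C k, fun γ => by simp⟩

theorem PolyBounded.size : C.PolyBounded C.sz :=
  ⟨X, fun γ => by simp⟩

theorem PolyBounded.add {f g : C.Γ → ℕ} (hf : C.PolyBounded f) (hg : C.PolyBounded g) :
    C.PolyBounded fun γ => f γ + g γ := by
  obtain ⟨p, hp⟩ := hf
  obtain ⟨q, hq⟩ := hg
  exact ⟨p + q, fun γ => by simpa using add_le_add (hp γ) (hq γ)⟩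

theorem PolyBounded.mul {f g : C.Γ → ℕ} (hf : C.PolyBounded f) (hg : C.PolyBounded g) :
    C.PolyBounded fun γ => f γ * g γ := by
  obtain ⟨p, hp⟩ := hf
  obtain ⟨q, hq⟩ := hg
  exact ⟨p * q, fun γ => by simpa using Nat.mul_le_mul (hp γ) (hq γ)⟩

theorem PolyBounded.push {f n : C.Γ → ℕ} (hf : C.PolyBounded f) :
    (C.push n).PolyBounded fun x => f x.1 :=
  hf.imp fun _ hp x => hp x.1

theorem PolyBounded.learn {f a : C.Γ → ℕ} (hf : C.PolyBounded f) : (C.learn a).PolyBounded f :=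
  hf

theorem ExpBounded.mono {f g : C.Γ → ℕ} (hg : C.ExpBounded g) (h : ∀ γ, f γ ≤ g γ) :
    C.ExpBounded f := by
  obtain ⟨p, hp⟩ := hg
  exact ⟨p, fun γ => (h γ).trans (hp γ)⟩

theorem PolyBounded.two_pow {f : C.Γ → ℕ} (hf : C.PolyBounded f) :
    C.ExpBounded fun γ => 2 ^ f γ := by
  obtain ⟨p, hp⟩ := hf
  exact ⟨p, fun γ => Nat.pow_le_pow_right two_pos (hp γ)⟩

theorem PolyBounded.expBounded {f : C.Γ → ℕ} (hf : C.PolyBounded f) : C.ExpBounded f :=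
  hf.two_pow.mono fun _ => Nat.lt_two_pow_self.le

theorem ExpBounded.const (k : ℕ) : C.ExpBounded fun _ => k :=
  (PolyBounded.const k).expBounded

theorem ExpBounded.mul {f g : C.Γ → ℕ} (hf : C.ExpBounded f) (hg : C.ExpBounded g) :
    C.ExpBounded fun γ => f γ * g γ := by
  obtain ⟨p, hp⟩ := hf
  obtain ⟨q, hq⟩ := hg
  exact ⟨p + q, fun γ => by simpa [pow_add] using Nat.mul_le_mul (hp γ) (hq γ)⟩

theorem ExpBounded.add {f g : C.Γ → ℕ} (hf : C.ExpBounded f) (hg : C.ExpBounded g) :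
    C.ExpBounded fun γ => f γ + g γ := by
  obtain ⟨p, hp⟩ := hf
  obtain ⟨q, hq⟩ := hg
  refine ⟨p + q + 1, fun γ => ?_⟩
  have h1 := hp γ
  have h2 := hq γ
  have h3 : 0 < 2 ^ p.eval (C.sz γ) := by positivity
  have h4 : 0 < 2 ^ q.eval (C.sz γ) := by positivity
  simp only [eval_add, eval_one, pow_add, pow_one]
  nlinarith [Nat.mul_le_mul h3 h4]

theorem ExpBounded.push {f n : C.Γ → ℕ} (hf : C.ExpBounded f) :
    (C.push n).ExpBounded fun x => f x.1 :=
  hf.imp fun _ hp x => hp x.1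

/-! ### Basic operations -/

theorem Does.congr {f f' : C.Γ → ℕ} {l l' : C.Γ → List ℕ} (h : C.Does f l) (hf : ∀ γ, f γ = f' γ)
    (hl : ∀ γ, l γ = l' γ) : C.Does f' l' := by
  obtain rfl : f = f' := funext hf
  obtain rfl : l = l' := funext hl
  exact h

theorem Does.learn {f a : C.Γ → ℕ} {l : C.Γ → List ℕ} (h : C.Does f l) :
    (C.learn a).Does f l := by
  refine ⟨h.1, fun loc r hloc => ?_⟩
  obtain ⟨P, T, hT, hP⟩ := h.2 loc r fun e he => hloc e (.inr he)
  exact ⟨P, T, hT, fun γ M o hM => hP γ M o fun e he => hM e (.inr he)⟩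

theorem Does.push {f n : C.Γ → ℕ} {l : C.Γ → List ℕ} (h : C.Does f l) :
    (C.push n).Does (fun x => f x.1) (fun x => l x.1) := by
  refine ⟨h.1.push, fun loc r hloc => ?_⟩
  obtain ⟨P, T, hT, hP⟩ := h.2 (fun e => loc fun x => e x.1) r
    fun e he => hloc _ (.inr ⟨e, he, rfl⟩)
  exact ⟨P, fun x => T x.1, hT.push, fun x M o hM => hP x.1 M o
    fun e he => hM _ (.inr ⟨e, he, rfl⟩)⟩

/-- Both programs use the same cell `r`: the value of the first one is discarded, only its output
remains. -/
theorem Does.seq {f g : C.Γ → ℕ} {l l' : C.Γ → List ℕ} (hf : C.Does f l) (hg : C.Does g l') :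
    C.Does g fun γ => l γ ++ l' γ := by
  refine ⟨hg.1, fun loc r hloc => ?_⟩
  obtain ⟨P, T, hT, hP⟩ := hf.2 loc r hloc
  obtain ⟨P', T', hT', hP'⟩ := hg.2 loc r hloc
  refine ⟨P.seq P', _, hT.add hT', fun γ M o hM => ?_⟩
  obtain ⟨t, M1, hE, ht, -, hM1⟩ := hP γ M o hM
  obtain ⟨t', M2, hE', ht', hr, hM2⟩ := hP' γ M1 (o ++ l γ)
    fun e he => (hM1 _ (hloc e he)).trans (hM e he)
  exact ⟨_, M2, by simpa using Exec.seq hE hE', add_le_add ht ht', hr,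
    fun i hi => (hM2 i hi).trans (hM1 i hi)⟩

theorem Comp.congr {f f' : C.Γ → ℕ} (h : C.Comp f) (hf : ∀ γ, f γ = f' γ) : C.Comp f' :=
  Does.congr h hf fun _ => rfl

theorem Comp.learn {f a : C.Γ → ℕ} (h : C.Comp f) : (C.learn a).Comp f :=
  Does.learn h

theorem Comp.push {f n : C.Γ → ℕ} (h : C.Comp f) : (C.push n).Comp fun x => f x.1 :=
  Does.push h

theorem Comp.known {e : C.Γ → ℕ} (he : e ∈ C.known) (h : C.ExpBounded e) : C.Comp e := by
  refine ⟨h, fun loc r hloc => ⟨.assign (.const r) (.mem (.const (loc e))), _, .const 4,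
    fun γ M o hM => ⟨_, _, by simpa using Exec.assign _ _ _, ?_, ?_, fun i hi => ?_⟩⟩⟩
  · simp [Expr.cost]
  · simp [Expr.eval, hM e he]
  · simp [Expr.eval, hi.ne]

theorem Comp.learned {a : C.Γ → ℕ} (h : C.ExpBounded a) : (C.learn a).Comp a :=
  .known (.inl rfl) h

theorem Comp.index {n : C.Γ → ℕ} (h : C.ExpBounded n) : (C.push n).Comp fun x => (x.2 : ℕ) :=
  .known (.inl rfl) (h.push.mono fun x => x.2.2.le)

/-- An operation of the machine that is applied to two computed values. -/
theorem Comp.binary {f g : C.Γ → ℕ} (hf : C.Comp f) (hg : C.Comp g) (op : Expr → Expr → Expr)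
    (F : C.Γ → ℕ → ℕ → ℕ) {c : ℕ}
    (hc : ∀ i j, (op (.mem (.const i)) (.mem (.const j))).cost ≤ c)
    (hF : ∀ γ i j M, (op (.mem (.const i)) (.mem (.const j))).eval (C.inp γ) M = F γ (M i) (M j))
    (hb : C.ExpBounded fun γ => F γ (f γ) (g γ)) :
    C.Comp fun γ => F γ (f γ) (g γ) := by
  refine ⟨hb, fun loc r hloc => ?_⟩
  obtain ⟨P, T, hT, hP⟩ := hf.2 loc r hloc
  -- The first value waits in cell `r` while the second is computed above it.
  obtain ⟨P', T', hT', hP'⟩ := hg.2 loc (r + 1) fun e he => (hloc e he).trans r.lt_succ_self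
  refine ⟨(P.seq P').seq (.assign (.const r) (op (.mem (.const r)) (.mem (.const (r + 1))))),
    _, (hT.add hT').add (.const (c + 2)), fun γ M o hM => ?_⟩
  obtain ⟨t, M1, hE, ht, hr, hM1⟩ := hP γ M o hM
  obtain ⟨t', M2, hE', ht', hr', hM2⟩ := hP' γ M1 o
    (fun e he => (hM1 _ (hloc e he)).trans (hM e he))
  simp only [List.append_nil] at hE hE' ⊢
  refine ⟨_, _, (hE.seq hE').seq (.assign _ _ _), ?_, ?_, fun i hi => ?_⟩
  · have := hc r (r + 1)
    simp only [Expr.cost] at this ⊢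
    omega
  · simp [Expr.eval, hF, hr', hM2 r r.lt_succ_self, hr]
  · simp [Expr.eval, hi.ne, hM1 i hi, hM2 i (hi.trans r.lt_succ_self)]

theorem Comp.const (k : ℕ) : C.Comp fun _ => k := by
  refine ⟨.const k, fun loc r hloc => ⟨.assign (.const r) (.const k), _, .const 3,
    fun γ M o hM => ⟨_, _, by simpa using Exec.assign _ _ _, ?_, ?_, fun i hi => ?_⟩⟩⟩
  · simp [Expr.cost]
  · simp [Expr.eval]
  · simp [Expr.eval, hi.ne]

theorem Comp.add {f g : C.Γ → ℕ} (hf : C.Comp f) (hg : C.Comp g) : C.Comp fun γ => f γ + g γ :=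
  hf.binary hg .add (fun _ x y => x + y) (c := 5) (fun _ _ => by simp [Expr.cost])
    (fun _ _ _ _ => rfl) (hf.1.add hg.1)

theorem Comp.sub {f g : C.Γ → ℕ} (hf : C.Comp f) (hg : C.Comp g) : C.Comp fun γ => f γ - g γ :=
  hf.binary hg .sub (fun _ x y => x - y) (c := 5) (fun _ _ => by simp [Expr.cost])
    (fun _ _ _ _ => rfl) (hf.1.mono fun _ => Nat.sub_le _ _)

theorem Comp.input {f : C.Γ → ℕ} (hf : C.Comp f) : C.Comp fun γ => (C.inp γ).getD (f γ) 0 :=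
  hf.binary hf (fun e _ => .input e) (fun γ x _ => (C.inp γ).getD x 0) (c := 3)
    (fun _ _ => by simp [Expr.cost]) (fun _ _ _ _ => rfl)
    (PolyBounded.size.expBounded.mono fun γ => C.inp_le γ _)

theorem Comp.write {f : C.Γ → ℕ} (hf : C.Comp f) : C.Writes fun γ => [f γ] := by
  refine ⟨.const 0, fun loc r hloc => ?_⟩
  obtain ⟨P, T, hT, hP⟩ := hf.2 loc r hloc
  refine ⟨(P.seq (.write (.mem (.const r)))).seq (.assign (.const r) (.const 0)), _,
    hT.add (.const 6), fun γ M o hM => ?_⟩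
  obtain ⟨t, M1, hE, ht, hr, hM1⟩ := hP γ M o hM
  have h1 := Exec.write (inp := C.inp γ) (.mem (.const r)) ⟨M1, o⟩
  simp only [Expr.eval, hr, List.append_nil] at h1 hE
  refine ⟨_, _, (hE.seq h1).seq (.assign _ _ _), ?_, ?_, fun i hi => ?_⟩
  · simp only [Expr.cost]
    omega
  · simp [Expr.eval]
  · simp [Expr.eval, hi.ne, hM1 i hi]

theorem Writes.append {l l' : C.Γ → List ℕ} (h : C.Writes l) (h' : C.Writes l') :
    C.Writes fun γ => l γ ++ l' γ :=
  Does.seq h h'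

theorem Comp.ite_ne_zero {c f g : C.Γ → ℕ} (hc : C.Comp c) (hf : C.Comp f) (hg : C.Comp g) :
    C.Comp fun γ => if c γ ≠ 0 then f γ else g γ := by
  refine ⟨(hf.1.add hg.1).mono fun γ => by split_ifs <;> omega, fun loc r hloc => ?_⟩
  obtain ⟨P, T, hT, hP⟩ := hc.2 loc r hloc
  obtain ⟨P1, T1, hT1, hP1⟩ := hf.2 loc r hloc
  obtain ⟨P2, T2, hT2, hP2⟩ := hg.2 loc r hloc
  refine ⟨P.seq (.cond (.mem (.const r)) P1 P2), _, (hT.add (hT1.add hT2)).add (.const 2),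
    fun γ M o hM => ?_⟩
  obtain ⟨t, M1, hE, ht, hr, hM1⟩ := hP γ M o hM
  simp only [List.append_nil] at hE ⊢
  by_cases h0 : c γ = 0
  · obtain ⟨t', M2, hE', ht', hr', hM2⟩ := hP2 γ M1 o
      (fun e he => (hM1 _ (hloc e he)).trans (hM e he))
    simp only [List.append_nil] at hE'
    refine ⟨_, M2, hE.seq (.cond_false (by simp [Expr.eval, hr, h0]) hE'), ?_, by simp [hr', h0],
      fun i hi => (hM2 i hi).trans (hM1 i hi)⟩
    simp only [Expr.cost]
    omega
  · obtain ⟨t', M2, hE', ht', hr', hM2⟩ := hP1 γ M1 o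
      (fun e he => (hM1 _ (hloc e he)).trans (hM e he))
    simp only [List.append_nil] at hE'
    refine ⟨_, M2, hE.seq (.cond_true (by simp [Expr.eval, hr, h0]) hE'), ?_, by simp [hr', h0],
      fun i hi => (hM2 i hi).trans (hM1 i hi)⟩
    simp only [Expr.cost]
    omega

/-! ### Loops -/

/-- Cell `r` holds the number of remaining rounds. A test costs `2`, and there is one more test than
there are rounds. -/
theorem _root_.RAM.Exec.forLoop {inp : List ℕ} {r n T : ℕ} {body : Prog} (I : ℕ → State → Prop)
    (hr : ∀ i s, I i s → s.mem r = n - i)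
    (hbody : ∀ i < n, ∀ s, I i s → ∃ t s', Exec inp body s t s' ∧ t ≤ T ∧ I (i + 1) s')
    {s : State} (h0 : I 0 s) :
    ∃ t s', Exec inp (.loop (.mem (.const r)) body) s t s' ∧ t ≤ (n + 1) * (T + 2) ∧ I n s' := by
  suffices h : ∀ k ≤ n, ∀ s, I (n - k) s → ∃ t s',
      Exec inp (.loop (.mem (.const r)) body) s t s' ∧ t ≤ (k + 1) * (T + 2) ∧ I n s' from
    h n le_rfl s (by simpa using h0)
  intro k
  induction k with
  | zero =>
    intro _ s hs
    refine ⟨_, s, .loop_false ?_, ?_, by simpa using hs⟩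
    · simp [Expr.eval, hr _ _ hs]
    · simp [Expr.cost]
  | succ k ih =>
    intro hk s hs
    obtain ⟨t, s', hE, ht, hs'⟩ := hbody (n - (k + 1)) (by omega) s hs
    obtain ⟨t', s'', hE', ht', hs''⟩ := ih (by omega) s' (by
      rwa [show n - (k + 1) + 1 = n - k by omega] at hs')
    refine ⟨_, s'', .loop_true ?_ hE hE', ?_, hs''⟩
    · simp only [Expr.eval, hr _ _ hs]
      omega
    · simp only [Expr.cost]
      linarith

/-- Primitive recursion with an accumulator, with an output in every round. -/
theorem Does.loop {n : C.Γ → ℕ} {acc : C.Γ → ℕ → ℕ} {l : (C.push n).Γ → List ℕ}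
    (hn : C.Comp n) (h0 : C.Comp fun γ => acc γ 0)
    (hs : ((C.push n).learn fun x => acc x.1 x.2).Does (fun x => acc x.1 (x.2 + 1)) l) :
    C.Does (fun γ => acc γ (n γ)) fun γ => (List.finRange (n γ)).flatMap fun i => l ⟨γ, i⟩ := by
  classical
  constructor
  · obtain ⟨p, hp⟩ := h0.1
    obtain ⟨q, hq⟩ := hs.1
    -- The last value of the accumulator is either the initial one or the result of the step at the
    -- last index, so the two given bounds suffice.
    refine ExpBounded.mono (ExpBounded.add ⟨p, fun _ => le_rfl⟩ ⟨q, fun _ => le_rfl⟩) fun γ => ?_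
    rcases hk : n γ with _ | k
    · exact (hp γ).trans (Nat.le_add_right _ _)
    · exact (hq ⟨γ, k, by omega⟩).trans (Nat.le_add_left _ _)
  intro loc r hloc
  obtain ⟨Pn, Tn, hTn, hPn⟩ := hn.2 loc r hloc
  obtain ⟨Pi, Ti, hTi, hPi⟩ := h0.2 loc (r + 1) fun e he => (hloc e he).trans (by omega)
  -- Cell `r` counts the remaining rounds, `r + 1` holds the accumulator, `r + 2` the index, and the
  -- body works from `r + 3` on.
  let aF : (C.push n).Γ → ℕ := fun x => acc x.1 x.2
  let iF : (C.push n).Γ → ℕ := fun x => x.2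
  -- Any other known function comes from one of the outer context and keeps the cell of a chosen
  -- such function. If a known function coincides with the accumulator or the index, the new cell is
  -- as good as the old one.
  let loc' : ((C.push n).Γ → ℕ) → ℕ := fun e =>
    if e = aF then r + 1 else if e = iF then r + 2 else
      if h : ∃ e' ∈ C.known, (fun x : (C.push n).Γ => e' x.1) = e then loc h.choose else 0
  have hloc' : ∀ (x : (C.push n).Γ) (M : ℕ → ℕ), (∀ e ∈ C.known, M (loc e) = e x.1) →
      M (r + 1) = acc x.1 x.2 → M (r + 2) = x.2 →
      ∀ e ∈ insert aF (C.push n).known, M (loc' e) = e x := by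
    intro x M hM h1 h2 e he
    by_cases hea : e = aF
    · simp [loc', hea, h1, aF]
    by_cases hei : e = iF
    · have : loc' e = r + 2 := (if_neg hea).trans (if_pos hei)
      rw [this, h2, hei]
    obtain he | he | he := he
    · exact absurd he hea
    · exact absurd he hei
    · have he' : ∃ e' ∈ C.known, (fun x : (C.push n).Γ => e' x.1) = e := he
      simp only [loc', hea, hei, if_false, dif_pos he']
      rw [hM _ he'.choose_spec.1]
      exact congrFun he'.choose_spec.2 x
  have hlt : ∀ e ∈ ((C.push n).learn aF).known, loc' e < r + 3 := by
    intro e he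
    simp only [loc']
    split_ifs with _ _ h
    · omega
    · omega
    · exact (hloc _ h.choose_spec.1).trans (by omega)
    · omega
  obtain ⟨Pb, Tb, ⟨p, hp⟩, hPb⟩ := hs.2 loc' (r + 3) hlt
  let body : Prog := ((Pb.seq (.assign (.const (r + 1)) (.mem (.const (r + 3))))).seq
    (.assign (.const (r + 2)) (.add (.mem (.const (r + 2))) (.const 1)))).seq
    (.assign (.const r) (.sub (.mem (.const r)) (.const 1)))
  let B : C.Γ → ℕ := fun γ => 2 ^ p.eval (C.sz γ)
  have hB : C.ExpBounded B := ⟨p, fun _ => le_rfl⟩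
  refine ⟨(((Pn.seq Pi).seq (.assign (.const (r + 2)) (.const 0))).seq
      (.loop (.mem (.const r)) body)).seq (.assign (.const r) (.mem (.const (r + 1)))),
    -- The three assignments at the end of the body cost `4 + 6 + 6`; the two around the loop cost
    -- `3 + 4`.
    fun γ => Tn γ + Ti γ + (n γ + 1) * (B γ + 16 + 2) + 7,
    ((hTn.add hTi).add ((hn.1.add (.const 1)).mul ((hB.add (.const 16)).add (.const 2)))).add
      (.const 7), fun γ M o hM => ?_⟩
  obtain ⟨t1, M1, hE1, ht1, hr1, hM1⟩ := hPn γ M o hM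
  obtain ⟨t2, M2, hE2, ht2, hr2, hM2⟩ := hPi γ M1 o
    fun e he => (hM1 _ (hloc e he)).trans (hM e he)
  simp only [List.append_nil] at hE1 hE2
  let I : ℕ → State → Prop := fun i s => s.mem r = n γ - i ∧ s.mem (r + 1) = acc γ i ∧
    s.mem (r + 2) = i ∧ (∀ j < r, s.mem j = M j) ∧
    s.out = o ++ ((List.finRange (n γ)).take i).flatMap fun j => l ⟨γ, j⟩
  have hbody : ∀ i < n γ, ∀ s, I i s → ∃ t s', Exec (C.inp γ) body s t s' ∧ t ≤ B γ + 16 ∧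
      I (i + 1) s' := by
    rintro i hi ⟨Ms, os⟩ ⟨h1, h2, h3, h4, rfl⟩
    obtain ⟨t, M', hE, ht, hr, hM'⟩ := hPb ⟨γ, i, hi⟩ Ms _
      (hloc' ⟨γ, i, hi⟩ Ms (fun e he => (h4 _ (hloc e he)).trans (hM e he)) h2 h3)
    refine ⟨_, _, ((hE.seq (.assign _ _ _)).seq (.assign _ _ _)).seq (.assign _ _ _), ?_, ?_⟩
    · have := ht.trans (hp ⟨γ, i, hi⟩)
      simp only [Expr.cost]
      change t ≤ B γ at this
      omega
    · simp only [] at h1 h2 h3 h4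
      have e0 := hM' r (by omega)
      have e2 := hM' (r + 2) (by omega)
      refine ⟨?_, ?_, ?_, fun j hj => ?_, ?_⟩
      · simp [Expr.eval, e0, h1]
        omega
      · simp [Expr.eval, hr]
      · simp [Expr.eval, e2, h3]
      · simp [Expr.eval, hj.ne, (show j ≠ r + 1 by omega), (show j ≠ r + 2 by omega),
          hM' j (by omega), h4 j hj]
      · simp [List.take_add_one, hi, List.flatMap_append]
  have hI0 : I 0 ⟨Function.update M2 (r + 2) 0, o⟩ := by
    refine ⟨?_, ?_, ?_, fun j hj => ?_, ?_⟩
    · simp [hM2 r (by omega), hr1]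
    · simp [hr2]
    · simp
    · simp [(show j ≠ r + 2 by omega), hM2 j (by omega), hM1 j hj]
    · simp
  obtain ⟨t3, ⟨M3, o3⟩, hE3, ht3, -, h31, -, h33, h34⟩ :=
    Exec.forLoop I (fun i s h => h.1) hbody hI0
  refine ⟨_, _, (((hE1.seq hE2).seq (.assign _ _ _)).seq (?_ : Exec _ _ _ t3 ⟨M3, _⟩)).seq
    (.assign _ _ _), ?_, ?_, fun i hi => ?_⟩
  · have h : o3 = _ := h34
    rw [List.take_of_length_le (by simp)] at h
    simpa [Expr.eval, h] using hE3
  · simp only [Expr.cost]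
    omega
  · simpa [Expr.eval] using h31
  · simpa [Expr.eval, hi.ne] using h33 i hi

/-- Primitive recursion. -/
theorem Comp.loop {n : C.Γ → ℕ} {acc : C.Γ → ℕ → ℕ} (hn : C.Comp n)
    (h0 : C.Comp fun γ => acc γ 0) (hb : (C.push n).ExpBounded fun x => acc x.1 x.2)
    (hs : ((C.push n).learn fun x => acc x.1 x.2).Comp (fun x => acc x.1 x.2) →
      ((C.push n).learn fun x => acc x.1 x.2).Comp fun x => acc x.1 (x.2 + 1)) :
    C.Comp fun γ => acc γ (n γ) :=
  (Does.loop hn h0 (hs (.learned hb))).congr (fun _ => rfl) fun γ => by simp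

theorem Writes.flatMap_finRange {n : C.Γ → ℕ} {l : (C.push n).Γ → List ℕ} (hn : C.Comp n)
    (h : (C.push n).Writes l) :
    C.Writes fun γ => (List.finRange (n γ)).flatMap fun i => l ⟨γ, i⟩ :=
  Does.loop (acc := fun _ _ => 0) hn (.const 0) h.learn

end Ctx

end RAM

namespace RAM.Ctx

variable {C : Ctx}

/-! ### Decidable predicates -/

theorem Dec.congr {p q : C.Γ → Prop} (h : C.Dec p) (hpq : ∀ γ, p γ ↔ q γ) : C.Dec q := by
  obtain rfl : p = q := funext fun γ => propext (hpq γ)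
  exact h

theorem Dec.learn {p : C.Γ → Prop} {a : C.Γ → ℕ} (h : C.Dec p) : (C.learn a).Dec p :=
  Comp.learn h

theorem Comp.ite {p : C.Γ → Prop} [∀ γ, Decidable (p γ)] {f g : C.Γ → ℕ} (hp : C.Dec p)
    (hf : C.Comp f) (hg : C.Comp g) : C.Comp fun γ => if p γ then f γ else g γ :=
  (Comp.ite_ne_zero hp hf hg).congr fun γ => by by_cases h : p γ <;> simp [h]

theorem Dec.ne_zero {f : C.Γ → ℕ} (hf : C.Comp f) : C.Dec fun γ => f γ ≠ 0 :=
  (Comp.ite_ne_zero hf (.const 1) (.const 0)).congr fun γ => by by_cases h : f γ = 0 <;> simp [h]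

theorem Dec.not {p : C.Γ → Prop} (hp : C.Dec p) : C.Dec fun γ => ¬ p γ := by
  classical
  exact (Comp.ite hp (.const 0) (.const 1)).congr fun γ => by by_cases h : p γ <;> simp [h]

theorem Dec.and {p q : C.Γ → Prop} (hp : C.Dec p) (hq : C.Dec q) : C.Dec fun γ => p γ ∧ q γ := by
  classical
  exact (Comp.ite hp hq (.const 0)).congr fun γ => by by_cases h : p γ <;> simp [h]

theorem Dec.or {p q : C.Γ → Prop} (hp : C.Dec p) (hq : C.Dec q) : C.Dec fun γ => p γ ∨ q γ :=
  (hp.not.and hq.not).not.congr fun γ => by tauto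

theorem Dec.lt {f g : C.Γ → ℕ} (hf : C.Comp f) (hg : C.Comp g) : C.Dec fun γ => f γ < g γ :=
  (Dec.ne_zero (hg.sub hf)).congr fun γ => by omega

theorem Dec.eq {f g : C.Γ → ℕ} (hf : C.Comp f) (hg : C.Comp g) : C.Dec fun γ => f γ = g γ :=
  ((Dec.lt hf hg).or (.lt hg hf)).not.congr fun γ => by omega

theorem Dec.exists_lt {n : C.Γ → ℕ} {p : C.Γ → ℕ → Prop} (hn : C.Comp n)
    (hp : (C.push n).Dec fun x => p x.1 x.2) : C.Dec fun γ => ∃ i < n γ, p γ i := by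
  classical
  refine (Comp.loop (acc := fun γ k => if ∃ i < k, p γ i then 1 else 0) hn
    ((Comp.const 0).congr fun γ => by simp)
    ((ExpBounded.const 1).mono fun x => by split_ifs <;> omega) fun h => ?_).congr fun γ => ?_
  · have key (k : ℕ) (q : ℕ → Prop) :
        ((if ∃ i < k, q i then 1 else 0) ≠ 0 ∨ q k) ↔ ∃ i < k + 1, q i := by
      rw [Nat.exists_lt_succ_right]
      by_cases h : ∃ i < k, q i <;> simp [h]
    exact (Comp.ite ((Dec.ne_zero h).or hp.learn) (.const 1) (.const 0)).congr fun x =>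
      if_congr (key _ _) rfl rfl
  · congr

/-! ### Arithmetic -/

/-- Repeated doubling; the polynomial bound on the exponent keeps the values exponentially bounded.
-/
theorem Comp.two_pow {f : C.Γ → ℕ} (hf : C.Comp f) (hb : C.PolyBounded f) :
    C.Comp fun γ => 2 ^ f γ :=
  Comp.loop (acc := fun _ k => 2 ^ k) hf (.const 1)
    (hb.push.two_pow.mono fun x => Nat.pow_le_pow_right two_pos x.2.2.le) fun h =>
    (h.add h).congr fun x => by ring

/-- Repeated addition: as many rounds as the value of `f` are affordable in exponential time.
Remainders and quotients are obtained by counting up to `f` in the same spirit. -/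
theorem Comp.mul {f g : C.Γ → ℕ} (hf : C.Comp f) (hg : C.Comp g) : C.Comp fun γ => f γ * g γ :=
  (Comp.loop (acc := fun γ k => k * g γ) hf ((Comp.const 0).congr fun γ => by simp)
    ((hf.1.mul hg.1).push.mono fun x => Nat.mul_le_mul_right _ x.2.2.le) fun h =>
    (h.add hg.push.learn).congr fun x => by ring)

theorem succ_mod_eq_ite (a b : ℕ) :
    (a + 1) % b = if a % b + 1 = b then 0 else a % b + 1 := by
  split_ifs with h
  · rw [← Nat.mod_add_mod, h, Nat.mod_self]
  · rcases Nat.eq_zero_or_pos b with rfl | hb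
    · simp
    · rw [← Nat.mod_add_mod, Nat.mod_eq_of_lt]
      have := Nat.mod_lt a hb
      omega

theorem Comp.mod {f g : C.Γ → ℕ} (hf : C.Comp f) (hg : C.Comp g) : C.Comp fun γ => f γ % g γ :=
  Comp.loop (acc := fun γ k => k % g γ) hf ((Comp.const 0).congr fun γ => by simp)
    (hf.1.push.mono fun x => (Nat.mod_le _ _).trans x.2.2.le) fun h =>
    (Comp.ite (.eq (h.add (.const 1)) hg.push.learn) (.const 0) (h.add (.const 1))).congr
      fun x => (succ_mod_eq_ite _ _).symm

theorem Comp.div {f g : C.Γ → ℕ} (hf : C.Comp f) (hg : C.Comp g) : C.Comp fun γ => f γ / g γ :=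
  Comp.loop (acc := fun γ k => k / g γ) hf ((Comp.const 0).congr fun γ => by simp)
    (hf.1.push.mono fun x => (Nat.div_le_self _ _).trans x.2.2.le) fun h =>
    (h.add (Comp.ite (.eq (((Comp.index hf.1).learn.add (.const 1)).mod hg.push.learn) (.const 0))
      (.const 1) (.const 0))).congr fun x => by
        simp only [Nat.succ_div, Nat.dvd_iff_mod_eq_zero]

theorem Comp.min {f g : C.Γ → ℕ} (hf : C.Comp f) (hg : C.Comp g) :
    C.Comp fun γ => min (f γ) (g γ) :=
  (Comp.ite (.lt hf hg) hf hg).congr fun γ => by split_ifs <;> omega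

/-- The bound is `k! ≤ k ^ k ≤ 2 ^ (k * k)`. -/
theorem Comp.factorial {f : C.Γ → ℕ} (hf : C.Comp f) (hb : C.PolyBounded f) :
    C.Comp fun γ => (f γ).factorial :=
  Comp.loop (acc := fun _ k => k.factorial) hf (.const 1)
    ((hb.mul hb).two_pow.push.mono fun x => (Nat.factorial_le x.2.2.le).trans <|
      (Nat.factorial_le_pow _).trans <| (Nat.pow_le_pow_left Nat.lt_two_pow_self.le _).trans_eq
        (pow_mul _ _ _).symm) fun h =>
    (((Comp.index hf.1).learn.add (.const 1)).mul h).congr fun x => by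
      simp [Nat.factorial_succ]

theorem Dec.testBit {f g : C.Γ → ℕ} (hf : C.Comp f) (hg : C.Comp g) (hb : C.PolyBounded g) :
    C.Dec fun γ => (f γ).testBit (g γ) = true :=
  (Dec.eq ((hf.div (hg.two_pow hb)).mod (.const 2)) (.const 1)).congr fun γ => by
    simp [Nat.testBit_eq_decide_div_mod_eq]

end RAM.Ctx

/-! ### Sets and relations as numbers -/

open Classical in
/-- The number whose binary digits describe the set of the `i < k` with `p i`. -/
noncomputable def setCode (k : ℕ) (p : ℕ → Prop) : ℕ :=
  ∑ i ∈ Finset.range k, if p i then 2 ^ i else 0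

theorem setCode_succ (k : ℕ) (p : ℕ → Prop) [Decidable (p k)] :
    setCode (k + 1) p = setCode k p + if p k then 2 ^ k else 0 := by
  classical
  rw [setCode, Finset.sum_range_succ, ← setCode]
  congr

theorem setCode_lt (k : ℕ) (p : ℕ → Prop) : setCode k p < 2 ^ k := by
  classical
  induction k with
  | zero => simp [setCode]
  | succ k ih =>
    rw [setCode_succ, pow_succ]
    split_ifs <;> omega

theorem testBit_setCode (k : ℕ) (p : ℕ → Prop) (j : ℕ) :
    (setCode k p).testBit j = true ↔ j < k ∧ p j := by
  classical
  induction k with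
  | zero => simp [setCode]
  | succ k ih =>
    have hlt := setCode_lt k p
    rw [setCode_succ]
    by_cases hp : p k
    · rw [if_pos hp, add_comm]
      rcases lt_trichotomy j k with h | rfl | h
      · rw [Nat.testBit_two_pow_add_gt h, ih]
        constructor <;> rintro ⟨_, h'⟩ <;> exact ⟨by omega, h'⟩
      · rw [Nat.testBit_two_pow_add_eq, Nat.testBit_lt_two_pow hlt]
        simp [hp]
      · rw [Nat.testBit_lt_two_pow]
        · simp
          omega
        · calc 2 ^ k + setCode k p < 2 ^ (k + 1) := by rw [pow_succ]; omega
            _ ≤ 2 ^ j := Nat.pow_le_pow_right two_pos h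
    · rw [if_neg hp, add_zero, ih, Nat.lt_succ_iff_lt_or_eq]
      constructor
      · rintro ⟨h, h'⟩
        exact ⟨.inl h, h'⟩
      · rintro ⟨h | rfl, h'⟩
        · exact ⟨h, h'⟩
        · exact absurd h' hp

theorem setCode_congr {k : ℕ} {p q : ℕ → Prop} (h : ∀ i < k, p i ↔ q i) :
    setCode k p = setCode k q := by
  classical
  exact Finset.sum_congr rfl fun i hi => by simp [h i (Finset.mem_range.1 hi)]

/-- The relation on the numbers below `v` that is coded by `c`. -/
def relOf (v c p q : ℕ) : Prop :=
  p < v ∧ q < v ∧ c.testBit (p * v + q) = true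

/-- A number that codes the restriction of `r` to the numbers below `v`. -/
noncomputable def relCode (v : ℕ) (r : ℕ → ℕ → Prop) : ℕ :=
  setCode (v * v) fun i => r (i / v) (i % v)

theorem relOf_relCode (v : ℕ) (r : ℕ → ℕ → Prop) (p q : ℕ) :
    relOf v (relCode v r) p q ↔ p < v ∧ q < v ∧ r p q := by
  refine and_congr_right fun hp => and_congr_right fun hq => ?_
  have h1 : (p * v + q) / v = p := by
    rw [mul_comm, Nat.mul_add_div (by omega), Nat.div_eq_of_lt hq, add_zero]
  have h2 : (p * v + q) % v = q := by
    rw [mul_comm, Nat.mul_add_mod, Nat.mod_eq_of_lt hq]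
  rw [relCode, testBit_setCode, h1, h2]
  refine and_iff_right ?_
  nlinarith

theorem relCode_congr {v : ℕ} {r r' : ℕ → ℕ → Prop} (h : ∀ p < v, ∀ q < v, r p q ↔ r' p q) :
    relCode v r = relCode v r' := by
  refine setCode_congr fun i hi => h _ (Nat.div_lt_of_lt_mul hi) _ (Nat.mod_lt _ ?_)
  rcases Nat.eq_zero_or_pos v with rfl | h
  · simp at hi
  · exact h

namespace RAM.Ctx

variable {C : Ctx}

protected theorem ExpBounded.setCode {k : C.Γ → ℕ} {p : C.Γ → ℕ → Prop} (hk : C.PolyBounded k) :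
    C.ExpBounded fun γ => setCode (k γ) (p γ) :=
  hk.two_pow.mono fun _ => (setCode_lt _ _).le

protected theorem Comp.setCode {k : C.Γ → ℕ} {p : C.Γ → ℕ → Prop} (hk : C.Comp k) (hb : C.PolyBounded k)
    (hp : (C.push k).Dec fun x => p x.1 x.2) : C.Comp fun γ => setCode (k γ) (p γ) := by
  classical
  have hi : (C.push k).PolyBounded fun x => (x.2 : ℕ) := hb.push.mono fun x => x.2.2.le
  exact Comp.loop (acc := fun γ i => setCode i (p γ)) hk
    ((Comp.const 0).congr fun γ => by simp [setCode]) (.setCode hi) fun h =>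
    (h.add (Comp.ite hp.learn ((Comp.index hk.1).two_pow hi).learn
      (.const 0))).congr fun x => (setCode_succ _ _).symm

protected theorem Dec.relOf {v c f g : C.Γ → ℕ} (hv : C.Comp v) (hb : C.PolyBounded v) (hc : C.Comp c)
    (hf : C.Comp f) (hg : C.Comp g) : C.Dec fun γ => relOf (v γ) (c γ) (f γ) (g γ) := by
  -- The bit position must be polynomially bounded even where `f` and `g` are not below `v`, so it
  -- is capped at `v * v`; the cap has no effect when both are below `v`.
  refine (((Dec.lt hf hv).and (.lt hg hv)).and (.testBit hc (f := c)
    (g := fun γ => min (f γ * v γ + g γ) (v γ * v γ)) (((hf.mul hv).add hg).min (hv.mul hv))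
    ((hb.mul hb).mono fun γ => min_le_right _ _))).congr fun γ => ?_
  rw [and_assoc]
  refine and_congr_right fun hp => and_congr_right fun hq => ?_
  rw [min_eq_left]
  nlinarith

protected theorem ExpBounded.relCode {v : C.Γ → ℕ} {r : C.Γ → ℕ → ℕ → Prop} (hb : C.PolyBounded v) :
    C.ExpBounded fun γ => relCode (v γ) (r γ) :=
  .setCode (hb.mul hb)

protected theorem Comp.relCode {v : C.Γ → ℕ} {r : C.Γ → ℕ → ℕ → Prop} (hv : C.Comp v)
    (hb : C.PolyBounded v)
    (hr : (C.push fun γ => v γ * v γ).Dec fun x => r x.1 (x.2 / v x.1) (x.2 % v x.1)) :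
    C.Comp fun γ => relCode (v γ) (r γ) :=
  .setCode (hv.mul hv) (hb.mul hb) hr

end RAM.Ctx

/-! ### Walks in finite graphs -/

section Walks

variable {α : Type*} {r : α → α → Prop}

/-- There is a walk of length `n` from `u` to `v`. -/
def Walk (r : α → α → Prop) : ℕ → α → α → Prop
  | 0, u, v => u = v
  | n + 1, u, v => ∃ w, r u w ∧ Walk r n w v

theorem walk_add {a b : ℕ} {u v : α} :
    Walk r (a + b) u v ↔ ∃ w, Walk r a u w ∧ Walk r b w v := by
  induction a generalizing u with
  | zero => simp [Walk]
  | succ a ih =>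
    rw [Nat.add_right_comm]
    simp only [Walk, ih]
    constructor
    · rintro ⟨w, h, w', h', h''⟩
      exact ⟨w', ⟨w, h, h'⟩, h''⟩
    · rintro ⟨w', ⟨w, h, h'⟩, h''⟩
      exact ⟨w, h, w', h', h''⟩

theorem walk_mul {c k : ℕ} {w : α} (h : Walk r c w w) : Walk r (c * k) w w := by
  induction k with
  | zero => rfl
  | succ k ih => exact walk_add.2 ⟨w, ih, h⟩

theorem Walk.exists_fun {n : ℕ} {u v : α} (h : Walk r n u v) :
    ∃ f : ℕ → α, f 0 = u ∧ f n = v ∧ ∀ i < n, r (f i) (f (i + 1)) := by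
  induction n generalizing u with
  | zero => exact ⟨fun _ => u, rfl, h, by simp⟩
  | succ n ih =>
    obtain ⟨w, hw, h⟩ := h
    obtain ⟨f, h0, hn, hf⟩ := ih h
    refine ⟨fun i => i.casesOn u f, rfl, hn, fun i hi => ?_⟩
    cases i with
    | zero => simpa [h0] using hw
    | succ i => exact hf i (by omega)

theorem walk_of_fun {n : ℕ} {f : ℕ → α} (hf : ∀ i < n, r (f i) (f (i + 1))) (i k : ℕ)
    (h : i + k ≤ n) : Walk r k (f i) (f (i + k)) := by
  induction k generalizing i with
  | zero => rfl
  | succ k ih =>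
    refine ⟨f (i + 1), hf i (by omega), ?_⟩
    have := ih (i + 1) (by omega)
    rwa [show i + 1 + k = i + (k + 1) by omega] at this

theorem Walk.reflTransGen {n : ℕ} {u v : α} (h : Walk r n u v) : Relation.ReflTransGen r u v := by
  induction n generalizing u with
  | zero => exact (show u = v from h) ▸ .refl
  | succ n ih =>
    obtain ⟨w, hw, h⟩ := h
    exact .head hw (ih h)

theorem exists_walk {u v : α} (h : Relation.ReflTransGen r u v) : ∃ n, Walk r n u v := by
  induction h using Relation.ReflTransGen.head_induction_on with
  | refl => exact ⟨0, rfl⟩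
  | head h _ ih =>
    obtain ⟨n, hn⟩ := ih
    exact ⟨n + 1, _, h, hn⟩

variable {s : Finset α} {N : ℕ}

theorem mem_of_fun {n : ℕ} {f : ℕ → α} (hs : ∀ u v, r u v → u ∈ s ∧ v ∈ s)
    (hf : ∀ i < n, r (f i) (f (i + 1))) (hn : 1 ≤ n) (i : ℕ) (hi : i ≤ n) : f i ∈ s := by
  cases i with
  | zero => exact (hs _ _ (hf 0 hn)).1
  | succ i => exact (hs _ _ (hf i hi)).2

/-- Walks can be shortened while their length is preserved modulo `c`. -/
theorem Walk.shorten (hs : ∀ u v, r u v → u ∈ s ∧ v ∈ s) (hN : s.card ≤ N) (c : ℕ) (hc : 0 < c)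
    {n : ℕ} {u v : α} (h : Walk r n u v) : ∃ k ≤ N * c, k ≡ n [MOD c] ∧ Walk r k u v := by
  induction n using Nat.strong_induction_on with
  | _ n ih =>
    rcases le_or_gt n (N * c) with hn | hn
    · exact ⟨n, hn, rfl, h⟩
    obtain ⟨f, rfl, rfl, hf⟩ := h.exists_fun
    have hmem := mem_of_fun hs hf (by omega)
    -- There are more than `N * c` positions but at most `N * c` pairs of a vertex and a residue
    -- modulo `c`. Cutting out the segment between two positions with the same pair removes a
    -- multiple of `c`.
    obtain ⟨i, hi, j, hj, hij, he⟩ := Finset.exists_ne_map_eq_of_card_lt_of_maps_to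
      (s := Finset.range (n + 1)) (t := s ×ˢ Finset.range c) (f := fun i => (f i, i % c))
      (by
        rw [Finset.card_product, Finset.card_range, Finset.card_range]
        have := Nat.mul_le_mul_right c hN
        omega)
      (fun i hi => by
        have hi : i < n + 1 := by simpa using hi
        exact Finset.mem_product.2 ⟨hmem i (by omega), Finset.mem_range.2 (Nat.mod_lt _ hc)⟩)
    simp only [Finset.mem_range, Prod.mk.injEq] at hi hj he
    wlog hlt : i < j generalizing i j
    · exact this j i hij.symm hj hi ⟨he.1.symm, he.2.symm⟩ (by omega)
    have h1 := walk_of_fun hf 0 i (by omega)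
    have h2 := walk_of_fun hf j (n - j) (by omega)
    rw [zero_add] at h1
    rw [show j + (n - j) = n by omega, ← he.1] at h2
    obtain ⟨k, hk, hkn, hw⟩ := ih (i + (n - j)) (by omega) (walk_add.2 ⟨_, h1, h2⟩)
    refine ⟨k, hk, hkn.trans ?_, hw⟩
    have : i + (n - j) ≡ j + (n - j) [MOD c] := Nat.ModEq.add_right _ he.2
    rwa [show j + (n - j) = n by omega] at this

/-- Two of the first `N + 1` vertices of the walk coincide. -/
theorem Walk.exists_cycle (hs : ∀ u v, r u v → u ∈ s ∧ v ∈ s) (hN : s.card ≤ N)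
    {n : ℕ} {u v : α} (h : Walk r n u v) (hn : 1 ≤ n) (hNn : N ≤ n) :
    ∃ a b c w, 1 ≤ c ∧ c ≤ N ∧ a + c + b = n ∧ Walk r a u w ∧ Walk r c w w ∧ Walk r b w v := by
  obtain ⟨f, rfl, rfl, hf⟩ := h.exists_fun
  have hmem := mem_of_fun hs hf hn
  obtain ⟨i, hi, j, hj, hij, he⟩ := Finset.exists_ne_map_eq_of_card_lt_of_maps_to
    (s := Finset.range (N + 1)) (t := s) (f := f) (by simpa using Nat.lt_succ_of_le hN)
    (fun i hi => hmem i (by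
      have hi : i < N + 1 := by simpa using hi
      omega))
  simp only [Finset.mem_range] at hi hj
  wlog hlt : i < j generalizing i j
  · exact this j i hij.symm he.symm hj hi (by omega)
  have h1 := walk_of_fun hf 0 i (by omega)
  have h2 := walk_of_fun hf i (j - i) (by omega)
  have h3 := walk_of_fun hf j (n - j) (by omega)
  rw [zero_add] at h1
  rw [show i + (j - i) = j by omega, ← he] at h2
  rw [show j + (n - j) = n by omega, ← he] at h3
  exact ⟨i, n - j, j - i, f i, by omega, by omega, by omega, h1, h2, h3⟩

/-- The lengths of the walks between two vertices are eventually periodic, with a quadratic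
preperiod. -/
theorem Walk.periodic (hs : ∀ u v, r u v → u ∈ s ∧ v ∈ s) (hN : s.card ≤ N) (hN1 : 1 ≤ N) {L : ℕ}
    (hL : ∀ c, 1 ≤ c → c ≤ N → c ∣ L) {n n' : ℕ} (hn : 2 * (N * N) ≤ n) (hn' : 2 * (N * N) ≤ n')
    (hnn : n ≡ n' [MOD L]) {u v : α} (h : Walk r n u v) : Walk r n' u v := by
  have hNN : N ≤ N * N := Nat.le_mul_self N
  -- The parts before and after the cycle are shortened modulo `c` to at most `N * c` each. What is
  -- missing to `n'` is then a multiple of `c`, since `c ∣ L`, and is filled with copies of the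
  -- cycle.
  obtain ⟨a, b, c, w, hc, hcN, hsum, ha, hcyc, hb⟩ := h.exists_cycle hs hN (by omega) (by omega)
  obtain ⟨a', ha', haa, ha⟩ := ha.shorten hs hN c hc
  obtain ⟨b', hb', hbb, hb⟩ := hb.shorten hs hN c hc
  have hNc : N * c ≤ N * N := Nat.mul_le_mul_left _ hcN
  obtain ⟨k, hk⟩ : c ∣ n' - (a' + b') := by
    refine (Nat.modEq_iff_dvd' (by omega)).1 ?_
    calc a' + b' ≡ a + b [MOD c] := haa.add hbb
      _ ≡ a + c + b [MOD c] := by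
        refine Nat.ModEq.add_right _ ?_
        simp [Nat.ModEq]
      _ = n := hsum
      _ ≡ n' [MOD c] := hnn.of_dvd (hL c hc hcN)
  have h2 := walk_add.2 ⟨w, walk_add.2 ⟨w, ha, walk_mul (k := k) hcyc⟩, hb⟩
  rwa [← hk, show a' + (n' - (a' + b')) + b' = n' by omega] at h2

theorem reflTransGen_iff_walk_le (hs : ∀ u v, r u v → u ∈ s ∧ v ∈ s) (hN : s.card ≤ N) {u v : α} :
    Relation.ReflTransGen r u v ↔ ∃ k ≤ N, Walk r k u v := by
  constructor
  · intro h
    obtain ⟨n, hn⟩ := exists_walk h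
    obtain ⟨k, hk, -, hw⟩ := hn.shorten hs hN 1 one_pos
    exact ⟨k, by simpa using hk, hw⟩
  · rintro ⟨k, -, h⟩
    exact h.reflTransGen

/-- A sequence of sets that is given by a linear recurrence. -/
theorem linear_recurrence_iff {Y : ℕ → α → Prop} {S : α → Prop}
    (hY : ∀ d u, Y (d + 1) u ↔ S u ∨ ∃ w, r u w ∧ Y d w) (d : ℕ) (u : α) :
    Y d u ↔ (∃ j < d, ∃ w, Walk r j u w ∧ S w) ∨ ∃ w, Walk r d u w ∧ Y 0 w := by
  induction d generalizing u with
  | zero => simp [Walk]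
  | succ d ih =>
    rw [hY]
    constructor
    · rintro (h | ⟨w, hw, h⟩)
      · exact .inl ⟨0, by omega, u, rfl, h⟩
      · rcases (ih w).1 h with ⟨j, hj, w', h1, h2⟩ | ⟨w', h1, h2⟩
        · exact .inl ⟨j + 1, by omega, w', ⟨w, hw, h1⟩, h2⟩
        · exact .inr ⟨w', ⟨w, hw, h1⟩, h2⟩
    · rintro (⟨j, hj, w', h1, h2⟩ | ⟨w', ⟨w, hw, h1⟩, h2⟩)
      · cases j with
        | zero => exact .inl ((show u = w' from h1) ▸ h2)
        | succ j =>
          obtain ⟨w, hw, h1⟩ := h1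
          exact .inr ⟨w, hw, (ih w).2 (.inl ⟨j, by omega, w', h1, h2⟩)⟩
      · exact .inr ⟨w, hw, (ih w).2 (.inr ⟨w', h1, h2⟩)⟩

/-- In the explicit solution, a walk that ends in `S` can be shortened to length at most `N`, so
this part no longer changes. The walks that end in `Y 0` have prescribed length, and `Walk.periodic`
applies to them. -/
theorem linear_recurrence_periodic (hs : ∀ u v, r u v → u ∈ s ∧ v ∈ s) (hN : s.card ≤ N)
    (hN1 : 1 ≤ N) {L : ℕ} (hL : ∀ c, 1 ≤ c → c ≤ N → c ∣ L) {Y : ℕ → α → Prop} {S : α → Prop}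
    (hY : ∀ d u, Y (d + 1) u ↔ S u ∨ ∃ w, r u w ∧ Y d w) {n n' : ℕ} (hn : 2 * (N * N) ≤ n)
    (hn' : 2 * (N * N) ≤ n') (hnn : n ≡ n' [MOD L]) (u : α) : Y n u ↔ Y n' u := by
  suffices h : ∀ {n n'}, 2 * (N * N) ≤ n → 2 * (N * N) ≤ n' → n ≡ n' [MOD L] → Y n u → Y n' u from
    ⟨h hn hn' hnn, h hn' hn hnn.symm⟩
  intro n n' hn hn' hnn h
  have hNN : N ≤ N * N := Nat.le_mul_self N
  rcases (linear_recurrence_iff hY n u).1 h with ⟨j, -, w, h1, h2⟩ | ⟨w, h1, h2⟩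
  · obtain ⟨k, hk, -, hw⟩ := h1.shorten hs hN 1 one_pos
    exact (linear_recurrence_iff hY n' u).2 (.inl ⟨k, by omega, w, hw, h2⟩)
  · exact (linear_recurrence_iff hY n' u).2 (.inr ⟨w, h1.periodic hs hN hN1 hL hn hn' hnn, h2⟩)

/-- A bounded increasing chain of finite sets that stops as soon as it pauses. -/
theorem chain_stabilizes {S : ℕ → Finset α} (hmono : ∀ h, S h ⊆ S (h + 1))
    (hstep : ∀ h, S h = S (h + 1) → S (h + 1) = S (h + 2)) (hs : ∀ h, S h ⊆ s) (hN : s.card ≤ N)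
    {h : ℕ} (hh : N ≤ h) : S h = S (h + 1) := by
  by_contra hne
  -- A pause before `h` would persist up to `h`. So the chain grows strictly up to `S (h + 1)`,
  -- which then has more than `N` elements.
  have hlt : ∀ k ≤ h, S (h - k) ≠ S (h - k + 1) := by
    intro k
    induction k with
    | zero => exact fun _ => hne
    | succ k ih =>
      intro hk he
      have := hstep _ he
      rw [show h - (k + 1) + 1 = h - k by omega, show h - (k + 1) + 2 = h - k + 1 by omega] at this
      exact ih (by omega) this
  have hcard : ∀ k ≤ h + 1, k ≤ (S k).card := by
    intro k
    induction k with
    | zero => simp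
    | succ k ih =>
      intro hk
      have h1 := hlt (h - k) (by omega)
      rw [show h - (h - k) = k by omega] at h1
      have h2 := Finset.card_lt_card ((hmono k).ssubset_of_ne h1)
      have h3 := ih (by omega)
      omega
  have h1 := hcard (h + 1) le_rfl
  have h2 := Finset.card_le_card (hs (h + 1))
  omega

end Walks

open Relation

/-! ### Silent runs -/

/-- The counter operations of a one-counter system with states below `v`: `up x` leads from counter
value `x` to `x + 1`, and `dn x` leads from `x + 1` to `x`. Both are constant above `m`. -/
structure CounterSystem where
  v : ℕ
  m : ℕ
  up : ℕ → ℕ → ℕ → Prop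
  dn : ℕ → ℕ → ℕ → Prop
  up_lt : ∀ {x p q}, up x p q → p < v ∧ q < v
  dn_lt : ∀ {x p q}, dn x p q → p < v ∧ q < v
  up_const : ∀ {x}, m ≤ x → up x = up m
  dn_const : ∀ {x}, m ≤ x → dn x = dn m

namespace CounterSystem

variable (K : CounterSystem)

/-- One step of a silent run. -/
inductive Silent : ℕ × ℕ → ℕ × ℕ → Prop
  | up {x p q : ℕ} (h : K.up x p q) : Silent (p, x) (q, x + 1)
  | dn {x p q : ℕ} (h : K.dn x p q) : Silent (p, x + 1) (q, x)

/-- The relation between states that is given by the silent runs from counter value `x` to `x` with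
counter values between `x` and `x + h`. -/
def above : ℕ → ℕ → ℕ → ℕ → Prop
  | 0, _, p, q => p < K.v ∧ p = q
  | h + 1, x, p, q =>
    p < K.v ∧ ReflTransGen (fun a b => ∃ c d, K.up x a c ∧ above h (x + 1) c d ∧ K.dn x d b) p q

/-- A height that suffices for the loops above any counter value. -/
def height : ℕ := K.v * K.v + K.m

/-- The loops above `x`. -/
def peak (x p q : ℕ) : Prop := K.above K.height x p q

/-- The relation between states that is given by the silent runs from counter value `x` to `x`. -/
def loops : ℕ → ℕ → ℕ → Prop
  | 0, p, q => K.peak 0 p q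
  | x + 1, p, q => K.peak (x + 1) p q ∨ ∃ a d, (∃ a', K.peak (x + 1) p a' ∧ K.dn x a' a) ∧
      (∃ d', K.up x d d' ∧ K.peak (x + 1) d' q) ∧ loops x a d

variable {K}

theorem above_lt {h x p q : ℕ} (hpq : K.above h x p q) : p < K.v ∧ q < K.v := by
  cases h with
  | zero => exact ⟨hpq.1, hpq.2 ▸ hpq.1⟩
  | succ h =>
    refine ⟨hpq.1, ?_⟩
    rcases ReflTransGen.cases_tail hpq.2 with h | ⟨b, _, c, d, -, -, h⟩
    · exact h ▸ hpq.1
    · exact (K.dn_lt h).2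

theorem above_refl {h x p : ℕ} (hp : p < K.v) : K.above h x p p := by
  cases h with
  | zero => exact ⟨hp, rfl⟩
  | succ h => exact ⟨hp, .refl⟩

theorem above_trans {h x p q s : ℕ} (hpq : K.above h x p q) (hqs : K.above h x q s) :
    K.above h x p s := by
  cases h with
  | zero => exact ⟨hpq.1, hpq.2.trans hqs.2⟩
  | succ h => exact ⟨hpq.1, hpq.2.trans hqs.2⟩

theorem above_succ {h x p q : ℕ} (hpq : K.above h x p q) : K.above (h + 1) x p q := by
  induction h generalizing x p q with
  | zero =>
    obtain ⟨hp, rfl⟩ := hpq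
    exact above_refl hp
  | succ h ih =>
    exact ⟨hpq.1, ReflTransGen.mono (fun a b ⟨c, d, h1, h2, h3⟩ => ⟨c, d, h1, ih h2, h3⟩) _ _ hpq.2⟩

theorem above_const {h x : ℕ} (hx : K.m ≤ x) : K.above h x = K.above h K.m := by
  induction h generalizing x with
  | zero => rfl
  | succ h ih =>
    funext p q
    simp only [above]
    rw [ih (show K.m ≤ x + 1 by omega), ih (Nat.le_succ K.m), K.up_const hx, K.dn_const hx]

/-- From `m` on, the relation does not depend on the level, so in `h` it is an increasing chain of
sets of at most `v * v` pairs in which each term determines the next. Each level below `m` needs one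
more unit of height. -/
theorem above_stable {h x : ℕ} (hh : K.v * K.v + (K.m - x) ≤ h) (p q : ℕ) :
    K.above h x p q ↔ K.above (h + 1) x p q := by
  classical
  induction h generalizing x p q with
  | zero =>
    have : K.v = 0 := by nlinarith [Nat.zero_le (K.m - x), Nat.zero_le (K.v * K.v)]
    constructor <;> intro h <;> have := above_lt h <;> omega
  | succ h ih =>
    rcases lt_or_ge x K.m with hx | hx
    · have := ih (x := x + 1) (by omega)
      simp only [above] at this ⊢
      simp only [this]
    · rw [above_const hx, above_const hx]
      let S : ℕ → Finset (ℕ × ℕ) := fun h =>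
        (Finset.range K.v ×ˢ Finset.range K.v).filter fun z => K.above h K.m z.1 z.2
      have hS (h : ℕ) (z : ℕ × ℕ) : z ∈ S h ↔ K.above h K.m z.1 z.2 := by
        simp only [S, Finset.mem_filter, Finset.mem_product, Finset.mem_range, and_iff_right_iff_imp]
        exact above_lt
      have h1 := chain_stabilizes (S := S) (N := K.v * K.v)
        (fun h z hz => (hS _ z).2 (above_succ ((hS _ z).1 hz)))
        (fun h he => by
          have he' : K.above h K.m = K.above (h + 1) K.m := by
            funext a b
            rw [← hS _ (a, b), he, hS]
          have e (h : ℕ) : K.above (h + 1) K.m = fun p q => p < K.v ∧ ReflTransGen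
              (fun a b => ∃ c d, K.up K.m a c ∧ K.above h K.m c d ∧ K.dn K.m d b) p q := by
            funext p q
            rw [above, above_const (Nat.le_succ K.m)]
          ext z
          rw [hS, hS, e h, e (h + 1), he'])
        (fun h => Finset.filter_subset _ _) (by simp) (show K.v * K.v ≤ h + 1 by omega)
      rw [← hS _ (p, q), h1, hS]

theorem peak_lt {x p q : ℕ} (h : K.peak x p q) : p < K.v ∧ q < K.v :=
  above_lt h

theorem peak_refl {x p : ℕ} (hp : p < K.v) : K.peak x p p :=
  above_refl hp

theorem peak_trans {x p q s : ℕ} (hpq : K.peak x p q) (hqs : K.peak x q s) : K.peak x p s :=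
  above_trans hpq hqs

/-- The run has height `height + 1` above `x`, which stability reduces to `height`. -/
theorem peak_of_up_dn {x p a b q : ℕ} (h1 : K.up x p a) (h2 : K.peak (x + 1) a b)
    (h3 : K.dn x b q) : K.peak x p q :=
  (above_stable (by rw [height]; omega) p q).2 ⟨(K.up_lt h1).1, .single ⟨a, b, h1, h2, h3⟩⟩

theorem peak_const {x : ℕ} (hx : K.m ≤ x) : K.peak x = K.peak K.m := by
  funext p q
  rw [peak, peak, above_const hx]

theorem silent_of_above {h x p q : ℕ} (hpq : K.above h x p q) :
    ReflTransGen K.Silent (p, x) (q, x) := by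
  induction h generalizing x p q with
  | zero => exact hpq.2 ▸ .refl
  | succ h ih =>
    obtain ⟨-, hpq⟩ := hpq
    induction hpq with
    | refl => exact .refl
    | tail _ h ih' =>
      obtain ⟨c, d, h1, h2, h3⟩ := h
      exact ((ih'.tail (.up h1)).trans (ih h2)).tail (.dn h3)

theorem loops_of_peak {x p q : ℕ} (h : K.peak x p q) : K.loops x p q := by
  cases x with
  | zero => exact h
  | succ x => exact .inl h

theorem loops_lt {x p q : ℕ} (h : K.loops x p q) : p < K.v ∧ q < K.v := by
  cases x with
  | zero => exact peak_lt h
  | succ x =>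
    rcases h with h | ⟨a, d, ⟨a', h1, -⟩, ⟨d', -, h2⟩, -⟩
    · exact peak_lt h
    · exact ⟨(peak_lt h1).1, (peak_lt h2).2⟩

theorem loops_refl {x p : ℕ} (hp : p < K.v) : K.loops x p p :=
  loops_of_peak (peak_refl hp)

/-- The recursion for `loops` allows only one excursion below the level. When two are joined, the
piece between them is a peak one level lower, so by induction both excursions merge into one. -/
theorem loops_trans {x p q s : ℕ} (hpq : K.loops x p q) (hqs : K.loops x q s) :
    K.loops x p s := by
  induction x generalizing p q s with
  | zero => exact peak_trans hpq hqs
  | succ x ih =>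
    rcases hpq with hpq | ⟨a, d, ⟨a', h1, h2⟩, ⟨d', h3, h4⟩, h5⟩ <;>
      rcases hqs with hqs | ⟨b, e, ⟨b', g1, g2⟩, ⟨e', g3, g4⟩, g5⟩
    · exact .inl (peak_trans hpq hqs)
    · exact .inr ⟨b, e, ⟨b', peak_trans hpq g1, g2⟩, ⟨e', g3, g4⟩, g5⟩
    · exact .inr ⟨a, d, ⟨a', h1, h2⟩, ⟨d', h3, peak_trans h4 hqs⟩, h5⟩
    · exact .inr ⟨a, e, ⟨a', h1, h2⟩, ⟨e', g3, g4⟩,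
        ih (ih h5 (loops_of_peak (peak_of_up_dn h3 (peak_trans h4 g1) g2))) g5⟩

theorem loops_of_dn_up {x p a b q : ℕ} (h1 : K.dn x p a) (h2 : K.loops x a b) (h3 : K.up x b q) :
    K.loops (x + 1) p q :=
  .inr ⟨a, b, ⟨p, peak_refl (K.dn_lt h1).1, h1⟩, ⟨q, h3, peak_refl (K.up_lt h3).2⟩, h2⟩

theorem loops_of_up_dn {x p a b q : ℕ} (h1 : K.up x p a) (h2 : K.loops (x + 1) a b)
    (h3 : K.dn x b q) : K.loops x p q := by
  rcases h2 with h2 | ⟨c, d, ⟨c', g1, g2⟩, ⟨d', g3, g4⟩, g5⟩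
  · exact loops_of_peak (peak_of_up_dn h1 h2 h3)
  · exact loops_trans (loops_trans (loops_of_peak (peak_of_up_dn h1 g1 g2)) g5)
      (loops_of_peak (peak_of_up_dn g3 g4 h3))

theorem silent_of_loops {x p q : ℕ} (h : K.loops x p q) :
    ReflTransGen K.Silent (p, x) (q, x) := by
  induction x generalizing p q with
  | zero => exact silent_of_above h
  | succ x ih =>
    rcases h with h | ⟨a, d, ⟨a', h1, h2⟩, ⟨d', h3, h4⟩, h5⟩
    · exact silent_of_above h
    · exact ((((silent_of_above h1).tail (.dn h2)).trans (ih h5)).tail (.up h3)).trans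
        (silent_of_above h4)

/-- The states that are reached by monotone runs, interleaved with loops, from state `p` and counter
value `x` to `x + d`. -/
def ascend (K : CounterSystem) (x p : ℕ) : ℕ → ℕ → Prop
  | 0, q => K.loops x p q
  | d + 1, q => ∃ a b, ascend K x p d a ∧ K.up (x + d) a b ∧ K.loops (x + d + 1) b q

/-- The states that are reached by monotone runs, interleaved with loops, from state `p` and counter
value `x` to the counter value `y` with `y + d = x`. -/
def descend (K : CounterSystem) (x p : ℕ) : ℕ → ℕ → Prop
  | 0, q => K.loops x p q
  | d + 1, q => ∃ a b, descend K x p d a ∧ K.dn (x - (d + 1)) a b ∧ K.loops (x - (d + 1)) b q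

theorem ascend_loops {x p d q s : ℕ} (h : K.ascend x p d q) (h' : K.loops (x + d) q s) :
    K.ascend x p d s := by
  cases d with
  | zero => exact loops_trans h h'
  | succ d =>
    obtain ⟨a, b, h1, h2, h3⟩ := h
    exact ⟨a, b, h1, h2, loops_trans h3 h'⟩

theorem descend_loops {x p d q s : ℕ} (h : K.descend x p d q) (h' : K.loops (x - d) q s) :
    K.descend x p d s := by
  cases d with
  | zero => exact loops_trans h h'
  | succ d =>
    obtain ⟨a, b, h1, h2, h3⟩ := h
    exact ⟨a, b, h1, h2, loops_trans h3 h'⟩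

/-- A further step in the current direction prolongs the factorization. A step back, together with
the last monotone step and the loop after it, forms a loop at the previous level and is absorbed
there. -/
theorem ascend_or_descend_of_silent {x p : ℕ} (hp : p < K.v) {c : ℕ × ℕ}
    (h : ReflTransGen K.Silent (p, x) c) :
    (∃ d, c.2 = x + d ∧ K.ascend x p d c.1) ∨ (∃ d, c.2 + d = x ∧ K.descend x p d c.1) := by
  induction h with
  | refl => exact .inl ⟨0, rfl, loops_refl hp⟩
  | @tail b c _ hs ih =>
    cases hs with
    | @up y q q' hu =>
      rcases ih with ⟨d, hd, h⟩ | ⟨d, hd, h⟩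
      · obtain rfl : y = x + d := hd
        exact .inl ⟨d + 1, rfl, q, q', h, hu, loops_refl (K.up_lt hu).2⟩
      · cases d with
        | zero =>
          obtain rfl : y = x := hd
          exact .inl ⟨1, rfl, q, q', h, hu, loops_refl (K.up_lt hu).2⟩
        | succ d =>
          obtain ⟨a, b, h1, h2, h3⟩ := h
          simp only [] at hd
          obtain rfl : y = x - (d + 1) := by omega
          refine .inr ⟨d, by simp only []; omega, descend_loops h1 ?_⟩
          have := loops_of_dn_up h2 h3 hu
          rwa [show x - (d + 1) + 1 = x - d by omega] at this
    | @dn y q q' hu =>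
      rcases ih with ⟨d, hd, h⟩ | ⟨d, hd, h⟩
      · cases d with
        | zero =>
          simp only [add_zero] at hd
          refine .inr ⟨1, hd, q, q', h, ?_⟩
          rw [show x - (0 + 1) = y by omega]
          exact ⟨hu, loops_refl (K.dn_lt hu).2⟩
        | succ d =>
          obtain ⟨a, b, h1, h2, h3⟩ := h
          simp only [] at hd
          obtain rfl : y = x + d := by omega
          exact .inl ⟨d, rfl, ascend_loops h1 (loops_of_up_dn h2 h3 hu)⟩
      · simp only [] at hd
        refine .inr ⟨d + 1, by simp only []; omega, q, q', h, ?_⟩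
        rw [show x - (d + 1) = y by omega]
        exact ⟨hu, loops_refl (K.dn_lt hu).2⟩

theorem silent_of_ascend {x p d q : ℕ} (h : K.ascend x p d q) :
    ReflTransGen K.Silent (p, x) (q, x + d) := by
  induction d generalizing q with
  | zero => exact silent_of_loops h
  | succ d ih =>
    obtain ⟨a, b, h1, h2, h3⟩ := h
    exact ((ih h1).tail (.up h2)).trans (silent_of_loops h3)

theorem silent_of_descend {y p d q : ℕ} (h : K.descend (y + d) p d q) :
    ReflTransGen K.Silent (p, y + d) (q, y) := by
  suffices H : ∀ x e, e ≤ x → ∀ q, K.descend x p e q →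
      ReflTransGen K.Silent (p, x) (q, x - e) by
    simpa using H (y + d) d (by omega) q h
  intro x e he
  induction e with
  | zero => exact fun q h => silent_of_loops h
  | succ e ih =>
    rintro q ⟨a, b, h1, h2, h3⟩
    have h4 : K.Silent (a, x - (e + 1) + 1) (b, x - (e + 1)) := .dn h2
    rw [show x - (e + 1) + 1 = x - e by omega] at h4
    exact ((ih (by omega) a h1).tail h4).trans (silent_of_loops h3)

theorem silent_iff_loops {x p q : ℕ} (hp : p < K.v) :
    ReflTransGen K.Silent (p, x) (q, x) ↔ K.loops x p q := by
  refine ⟨fun h => ?_, silent_of_loops⟩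
  rcases ascend_or_descend_of_silent hp h with ⟨d, hd, h⟩ | ⟨d, hd, h⟩
  · obtain rfl : d = 0 := by simpa using hd
    exact h
  · obtain rfl : d = 0 := by simpa using hd
    exact h

/-- The set of states that are reachable at `y + 1` depends only on the one at `y`. This justifies
the monotone moves of the determinized automaton. -/
theorem silent_up_iff {x y p q : ℕ} (hp : p < K.v) (hxy : x ≤ y) :
    ReflTransGen K.Silent (p, x) (q, y + 1) ↔
      ∃ a b, ReflTransGen K.Silent (p, x) (a, y) ∧ K.up y a b ∧ K.loops (y + 1) b q := by
  constructor
  · intro h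
    rcases ascend_or_descend_of_silent hp h with ⟨d, hd, g⟩ | ⟨d, hd, g⟩
    · simp only [] at hd
      obtain ⟨d, rfl⟩ : ∃ e, d = e + 1 := ⟨d - 1, by omega⟩
      obtain rfl : y = x + d := by omega
      obtain ⟨a, b, h1, h2, h3⟩ := g
      exact ⟨a, b, silent_of_ascend h1, h2, h3⟩
    · simp only [] at hd
      omega
  · rintro ⟨a, b, h1, h2, h3⟩
    exact (h1.tail (.up h2)).trans (silent_of_loops h3)

theorem silent_dn_iff {x y p q : ℕ} (hp : p < K.v) (hxy : y + 1 ≤ x) :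
    ReflTransGen K.Silent (p, x) (q, y) ↔
      ∃ a b, ReflTransGen K.Silent (p, x) (a, y + 1) ∧ K.dn y a b ∧ K.loops y b q := by
  constructor
  · intro h
    rcases ascend_or_descend_of_silent hp h with ⟨d, hd, g⟩ | ⟨d, hd, g⟩
    · simp only [] at hd
      omega
    · simp only [] at hd
      obtain ⟨d, rfl⟩ : ∃ e, d = e + 1 := ⟨d - 1, by omega⟩
      obtain rfl : x = y + 1 + d := by omega
      obtain ⟨a, b, h1, h2, h3⟩ := g
      rw [show y + 1 + d - (d + 1) = y by omega] at h2 h3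
      exact ⟨a, b, silent_of_descend h1, h2, h3⟩
  · rintro ⟨a, b, h1, h2, h3⟩
    exact (h1.tail (.dn h2)).trans (silent_of_loops h3)

/-- The loops at counter value `x` depend on `x` in an eventually periodic way. -/
theorem loops_periodic (hv : 0 < K.v) {x y : ℕ}
    (hx : K.m + 2 * ((K.v * K.v) * (K.v * K.v)) ≤ x)
    (hy : K.m + 2 * ((K.v * K.v) * (K.v * K.v)) ≤ y)
    (hxy : x ≡ y [MOD (K.v * K.v).factorial]) : K.loops x = K.loops y := by
  -- An edge peels off the first descent and the matching last ascent of a loop; from level `m` on,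
  -- this relation is the same at every level.
  let r : ℕ × ℕ → ℕ × ℕ → Prop := fun z w =>
    (∃ a', K.peak K.m z.1 a' ∧ K.dn K.m a' w.1) ∧ ∃ d', K.up K.m w.2 d' ∧ K.peak K.m d' z.2
  let Y : ℕ → ℕ × ℕ → Prop := fun d z => K.loops (K.m + d) z.1 z.2
  have hY : ∀ d z, Y (d + 1) z ↔ K.peak K.m z.1 z.2 ∨ ∃ w, r z w ∧ Y d w := by
    intro d z
    simp only [Y, r]
    rw [← add_assoc, loops, K.up_const (Nat.le_add_right _ _), K.dn_const (Nat.le_add_right _ _),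
      peak_const (by omega)]
    simp only [Prod.exists, and_assoc]
  obtain ⟨d, rfl⟩ := Nat.exists_eq_add_of_le (show K.m ≤ x by omega)
  obtain ⟨e, rfl⟩ := Nat.exists_eq_add_of_le (show K.m ≤ y by omega)
  funext p q
  refine propext (linear_recurrence_periodic (r := r) (Y := Y)
    (s := Finset.range K.v ×ˢ Finset.range K.v) (N := K.v * K.v) ?_ (by simp)
    (Nat.mul_pos hv hv) (fun c hc => Nat.dvd_factorial hc) hY (by omega) (by omega)
    (Nat.ModEq.add_left_cancel' _ hxy) (p, q))
  rintro ⟨a, b⟩ ⟨c, d⟩ ⟨⟨a', h1, h2⟩, d', h3, h4⟩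
  simp only [Finset.mem_product, Finset.mem_range]
  exact ⟨⟨(peak_lt h1).1, (peak_lt h4).2⟩, (K.dn_lt h2).2, (K.up_lt h3).1⟩

end CounterSystem

instance : Fintype CounterOp :=
  ⟨{.inc, .dec}, fun o => by cases o <;> simp⟩

/-! ### The determinized automaton, as a function of the encoded automaton -/

namespace Det

section Input

variable (w : List ℕ)

/-- The number of states. -/
def nS : ℕ := w.getD 0 0

/-- The number of letters. -/
def nL : ℕ := w.getD 1 0

/-- The threshold. -/
def thr : ℕ := w.getD 2 0

/-- The initial state. -/
def ini : ℕ := w.getD 3 0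

def IsFinal (q : ℕ) : Prop := w.getD (4 + q) 0 ≠ 0

/-- The table starts after four header entries and the table of the final states. The label `nL w`
is the increment and `nL w + 1` the decrement. -/
def HasTrans (p k σ q : ℕ) : Prop :=
  w.getD (4 + nS w + (((p * (thr w + 1) + k) * (nL w + 2) + σ) * nS w + q)) 0 ≠ 0

/-- The increments, where `nS w` serves as an additional absorbing state that is entered from the
final states. -/
def Up (x p q : ℕ) : Prop :=
  (p < nS w ∧ q < nS w ∧ HasTrans w p (min x (thr w)) (nL w) q) ∨
    ((p = nS w ∨ (p < nS w ∧ IsFinal w p)) ∧ q = nS w)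

/-- The decrements. -/
def Dn (x p q : ℕ) : Prop :=
  (p < nS w ∧ q < nS w ∧ HasTrans w p (min (x + 1) (thr w)) (nL w + 1) q) ∨ (p = nS w ∧ q = nS w)

/-- The state `nS w` makes acceptance a property of loops: a silent run that reaches a final state
can enter it and then bring the counter back to its original value. -/
def sys : CounterSystem where
  v := nS w + 1
  m := thr w
  up := Up w
  dn := Dn w
  up_lt h := by
    unfold Up at h
    omega
  dn_lt h := by
    unfold Dn at h
    omega
  up_const {x} hx := by
    funext p q
    simp only [Up, min_eq_right hx, min_self]
  dn_const {x} hx := by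
    funext p q
    simp only [Dn, min_eq_right (show thr w ≤ x + 1 by omega),
      min_eq_right (Nat.le_succ (thr w))]

/-- The number of pairs of states. -/
def nPairs : ℕ := (nS w + 1) * (nS w + 1)

/-- The period of the loops. -/
def period : ℕ := (nPairs w).factorial

/-- The threshold of the determinized automaton. -/
def bigThr : ℕ := thr w + 2 * (nPairs w * nPairs w)

/-- A counter value that passes the test `k` and is `ρ` modulo the period. -/
def repr (k ρ : ℕ) : ℕ := if k < bigThr w then k else bigThr w * period w + ρ

/-- States of the determinized automaton consist of a mode (after a letter, not accepting: `0`;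
after an increment: `1`; after a decrement: `2`; after a letter, accepting: `3`), a residue of the
counter value, and a set of states. -/
def pack (mode ρ S : ℕ) : ℕ := (mode * period w + ρ) * 2 ^ nS w + S

/-- There is a silent run to `q` from some state in `S`, back to the counter value `x`. -/
def Reachable (S x q : ℕ) : Prop :=
  ∃ p < nS w, S.testBit p = true ∧ (sys w).loops x p q

/-- Loops are taken before the step and not after it. The set is thus only known up to loops at the
new value; they are supplied by the next use of `Reachable`. -/
noncomputable def nextSet (S x : ℕ) (t : ℕ → ℕ → Prop) : ℕ :=
  setCode (nS w) fun q => ∃ p < nS w, Reachable w S x p ∧ t p q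

open Classical in
noncomputable def letterMode (S x : ℕ) : ℕ :=
  if Reachable w S x (nS w) then 3 else 0

noncomputable def letterState (ρ S x : ℕ) : ℕ := pack w (letterMode w S x) ρ S

/-- A change of direction between two letters empties the set. Adding `period w - 1` takes the
residue to its predecessor. -/
noncomputable def next (mode ρ S x σ : ℕ) : ℕ :=
  if σ < nL w then
    letterState w ρ (nextSet w S x fun p q => HasTrans w p (min x (thr w)) σ q) x
  else if σ = nL w then
    pack w 1 ((ρ + 1) % period w) (if mode = 2 then 0 else nextSet w S x (Up w x))
  else
    pack w 2 ((ρ + (period w - 1)) % period w) (if mode = 1 then 0 else nextSet w S x (Dn w (x - 1)))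

noncomputable def delta (st k σ : ℕ) : ℕ :=
  next w (st / 2 ^ nS w / period w) (st / 2 ^ nS w % period w) (st % 2 ^ nS w)
    (repr w k (st / 2 ^ nS w % period w)) σ

noncomputable def start : ℕ := letterState w 0 (2 ^ ini w) 0

/-- The number of states of the determinized automaton. -/
def nStates : ℕ := 4 * period w * 2 ^ nS w

variable {w}

theorem period_pos : 0 < period w := Nat.factorial_pos _

theorem pack_lt {mode ρ S : ℕ} (hm : mode ≤ 3) (hρ : ρ < period w) (hS : S < 2 ^ nS w) :
    pack w mode ρ S < nStates w := by
  have h1 : mode * period w + ρ + 1 ≤ 4 * period w := by nlinarith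
  have h2 := Nat.mul_le_mul_right (2 ^ nS w) h1
  rw [pack, nStates]
  linarith

theorem pack_mod {mode ρ S : ℕ} (hS : S < 2 ^ nS w) : pack w mode ρ S % 2 ^ nS w = S := by
  rw [pack, add_comm, Nat.add_mul_mod_self_right, Nat.mod_eq_of_lt hS]

theorem pack_div {mode ρ S : ℕ} (hS : S < 2 ^ nS w) :
    pack w mode ρ S / 2 ^ nS w = mode * period w + ρ := by
  rw [pack, mul_comm, Nat.mul_add_div (by positivity), Nat.div_eq_of_lt hS, add_zero]

theorem pack_div_mod {mode ρ S : ℕ} (hρ : ρ < period w) (hS : S < 2 ^ nS w) :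
    pack w mode ρ S / 2 ^ nS w % period w = ρ := by
  rw [pack_div hS, add_comm, Nat.add_mul_mod_self_right, Nat.mod_eq_of_lt hρ]

theorem pack_div_div {mode ρ S : ℕ} (hρ : ρ < period w) (hS : S < 2 ^ nS w) :
    pack w mode ρ S / 2 ^ nS w / period w = mode := by
  rw [pack_div hS, mul_comm, Nat.mul_add_div period_pos, Nat.div_eq_of_lt hρ, add_zero]

theorem nextSet_lt (S x : ℕ) (t : ℕ → ℕ → Prop) : nextSet w S x t < 2 ^ nS w :=
  setCode_lt _ _

theorem testBit_nextSet {S x q : ℕ} {t : ℕ → ℕ → Prop} :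
    (nextSet w S x t).testBit q = true ↔ q < nS w ∧ ∃ p < nS w, Reachable w S x p ∧ t p q :=
  testBit_setCode _ _ _

theorem letterMode_le (S x : ℕ) : letterMode w S x ≤ 3 := by
  rw [letterMode]
  split_ifs <;> omega

theorem next_lt {mode ρ S x σ : ℕ} (hρ : ρ < period w) : next w mode ρ S x σ < nStates w := by
  have := Nat.two_pow_pos (nS w)
  unfold next
  split_ifs
  · exact pack_lt (letterMode_le _ _) hρ (nextSet_lt _ _ _)
  · exact pack_lt (by omega) (Nat.mod_lt _ period_pos) this
  · exact pack_lt (by omega) (Nat.mod_lt _ period_pos) (nextSet_lt _ _ _)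
  · exact pack_lt (by omega) (Nat.mod_lt _ period_pos) this
  · exact pack_lt (by omega) (Nat.mod_lt _ period_pos) (nextSet_lt _ _ _)

theorem delta_lt (st k σ : ℕ) : delta w st k σ < nStates w :=
  next_lt (Nat.mod_lt _ period_pos)

theorem start_lt (h : ini w < nS w) : start w < nStates w :=
  pack_lt (letterMode_le _ _) period_pos (Nat.pow_lt_pow_right (by omega) h)

theorem delta_pack {mode ρ S k σ : ℕ} (hρ : ρ < period w) (hS : S < 2 ^ nS w) :
    delta w (pack w mode ρ S) k σ = next w mode ρ S (repr w k ρ) σ := by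
  rw [delta, pack_mod hS, pack_div_mod hρ hS, pack_div_div hρ hS]

theorem nPairs_pos : 0 < nPairs w := by
  unfold nPairs
  positivity

theorem thr_lt_bigThr : thr w < bigThr w := by
  have := Nat.mul_pos (nPairs_pos (w := w)) (nPairs_pos (w := w))
  unfold bigThr
  omega

/-- The determinized automaton does not see the difference between the counter value `x` and its
representative. -/
theorem repr_cases (x : ℕ) : repr w (min x (bigThr w)) (x % period w) = x ∨
    (bigThr w ≤ x ∧ bigThr w ≤ repr w (min x (bigThr w)) (x % period w) ∧
      (sys w).loops (repr w (min x (bigThr w)) (x % period w)) = (sys w).loops x) := by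
  rcases lt_or_ge x (bigThr w) with h | h
  · left
    rw [min_eq_left h.le, repr, if_pos h]
  · right
    have h1 : repr w (min x (bigThr w)) (x % period w) =
        bigThr w * period w + x % period w := by
      rw [min_eq_right h, repr, if_neg (lt_irrefl _)]
    have h2 : bigThr w ≤ bigThr w * period w + x % period w :=
      (Nat.le_mul_of_pos_right _ period_pos).trans (Nat.le_add_right _ _)
    rw [h1]
    -- `bigThr` is exactly the preperiod of the loops, and `bigThr w * period w` does not change
    -- residues.
    refine ⟨h, h2, CounterSystem.loops_periodic (Nat.succ_pos _) h2 h ?_⟩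
    have : (bigThr w * period w + x % period w) % period w = x % period w := by
      rw [mul_comm, Nat.mul_add_mod, Nat.mod_mod]
    exact this

theorem reachable_repr (S x q : ℕ) :
    Reachable w S (repr w (min x (bigThr w)) (x % period w)) q ↔ Reachable w S x q := by
  rcases repr_cases (w := w) x with h | ⟨-, -, h⟩
  · rw [h]
  · simp only [Reachable, h]

theorem min_repr_thr (x : ℕ) :
    min (repr w (min x (bigThr w)) (x % period w)) (thr w) = min x (thr w) := by
  have := thr_lt_bigThr (w := w)
  rcases repr_cases (w := w) x with h | ⟨h1, h2, -⟩
  · rw [h]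
  · omega

theorem up_repr (x : ℕ) : Up w (repr w (min x (bigThr w)) (x % period w)) = Up w x := by
  have := thr_lt_bigThr (w := w)
  rcases repr_cases (w := w) x with h | ⟨h1, h2, -⟩
  · rw [h]
  · exact ((sys w).up_const (by simp only [sys]; omega)).trans
      ((sys w).up_const (by simp only [sys]; omega)).symm

theorem dn_repr (x : ℕ) :
    Dn w (repr w (min (x + 1) (bigThr w)) ((x + 1) % period w) - 1) = Dn w x := by
  have := thr_lt_bigThr (w := w)
  rcases repr_cases (w := w) (x + 1) with h | ⟨h1, h2, -⟩
  · rw [h, Nat.add_sub_cancel]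
  · exact ((sys w).dn_const (by simp only [sys]; omega)).trans
      ((sys w).dn_const (by simp only [sys]; omega)).symm

theorem silent_top {x : ℕ} {c : ℕ × ℕ} (h : ReflTransGen (sys w).Silent (nS w, x) c) :
    c.1 = nS w := by
  induction h with
  | refl => rfl
  | tail _ h ih =>
    cases h with
    | up h =>
      have h : Up w _ _ _ := h
      simp only [Up] at h ih
      omega
    | dn h =>
      have h : Dn w _ _ _ := h
      simp only [Dn] at h ih
      omega

theorem lt_of_loops {x p q : ℕ} (h : (sys w).loops x p q) (hq : q < nS w) : p < nS w := by
  have h1 : p < nS w + 1 := (CounterSystem.loops_lt h).1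
  by_contra hp
  obtain rfl : p = nS w := by omega
  have : q = nS w := silent_top (CounterSystem.silent_of_loops h)
  omega

end Input

/-! ### Words -/

section Words

variable {α : Type*} {s : ℕ} (w : List ℕ) (eα : α ≃ Fin s)

/-- The numbers of the labels. -/
def lab : α ⊕ CounterOp → ℕ
  | .inl a => eα a
  | .inr .inc => s
  | .inr .dec => s + 1

/-- The possible states after a run that ends with the given letter. -/
def wordStep (c : (ℕ → Prop) × ℕ) (l : α × ℕ) : (ℕ → Prop) × ℕ :=
  (fun q => q < nS w ∧ ∃ p < nS w,
    (∃ p₀, c.1 p₀ ∧ ReflTransGen (sys w).Silent (p₀, c.2) (p, l.2)) ∧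
      HasTrans w p (min l.2 (thr w)) (eα l.1) q, l.2)

/-- The possible states, and the counter value, directly after the last letter of a word. -/
def after (u : List (α × ℕ)) : (ℕ → Prop) × ℕ :=
  u.foldl (wordStep w eα) (fun q => q = ini w, 0)

def Accepts (u : List (α × ℕ)) : Prop :=
  ∃ p, (after w eα u).1 p ∧ (sys w).loops (after w eα u).2 p (nS w)

variable {w eα}

theorem after_append (u : List (α × ℕ)) (l : α × ℕ) :
    after w eα (u ++ [l]) = wordStep w eα (after w eα u) l := by
  simp [after]

theorem lt_of_after (hi : ini w < nS w) {u : List (α × ℕ)} {p : ℕ} (h : (after w eα u).1 p) :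
    p < nS w := by
  rcases List.eq_nil_or_concat u with rfl | ⟨u, l, rfl⟩
  · exact (show p = ini w from h) ▸ hi
  · rw [List.concat_eq_append, after_append] at h
    exact h.1

theorem encFrom_append (c : (ℕ → Prop) × ℕ) (u : List (α × ℕ)) (a : α) (y : ℕ) :
    encFrom c.2 (u ++ [(a, y)]) =
      encFrom c.2 u ++ opsBetween α (u.foldl (wordStep w eα) c).2 y ++ [.inl a] := by
  induction u generalizing c with
  | nil => simp [encFrom]
  | cons l u ih =>
    have := ih (wordStep w eα c l)
    simp only [wordStep] at this
    simp [encFrom, this, wordStep]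

theorem enc_append (u : List (α × ℕ)) (a : α) (y : ℕ) :
    enc (u ++ [(a, y)]) = enc u ++ opsBetween α (after w eα u).2 y ++ [.inl a] :=
  encFrom_append (fun q => q = ini w, 0) u a y

theorem opsBetween_self (x : ℕ) : opsBetween α x x = [] := by
  simp [opsBetween]

theorem opsBetween_inc {x y : ℕ} (h : x ≤ y) :
    opsBetween α x (y + 1) = opsBetween α x y ++ [.inr .inc] := by
  have h1 : ((y + 1 : ℕ) - (x : ℤ)).natAbs = ((y : ℤ) - x).natAbs + 1 := by omega
  rw [opsBetween, opsBetween, if_pos (by omega), if_pos (by omega), h1, List.replicate_succ']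

theorem opsBetween_dec {x y : ℕ} (h : y + 1 ≤ x) :
    opsBetween α x y = opsBetween α x (y + 1) ++ [.inr .dec] := by
  have h1 : ((y : ℤ) - (x : ℤ)).natAbs = ((y + 1 : ℕ) - (x : ℤ)).natAbs + 1 := by omega
  rw [opsBetween, opsBetween, if_neg (by omega), h1, List.replicate_succ']
  rcases h.eq_or_lt with h | h
  · simp [← h]
  · rw [if_neg (by omega)]

end Words

end Det

/-! ### Extending runs at the end -/

namespace OCA

variable {Q α : Type*} {A : OCA Q α}

theorem PartialRun.append {c c' c'' : Q × ℕ} {τ τ' : List ((α × ℕ) ⊕ CounterOp)}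
    (h : A.PartialRun c τ c') (h' : A.PartialRun c' τ' c'') : A.PartialRun c (τ ++ τ') c'' := by
  induction h with
  | nil => exact h'
  | cons hs _ ih => exact .cons hs (ih h')

theorem PartialRun.snoc {c c' c'' : Q × ℕ} {τ : List ((α × ℕ) ⊕ CounterOp)}
    {t : (α × ℕ) ⊕ CounterOp} (h : A.PartialRun c τ c') (h' : A.Step c' t c'') :
    A.PartialRun c (τ ++ [t]) c'' :=
  h.append (.cons h' (.nil _))

/-- Induction on partial runs from the end. -/
theorem PartialRun.snoc_induction {c : Q × ℕ} {p : List ((α × ℕ) ⊕ CounterOp) → Q × ℕ → Prop}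
    (hnil : p [] c) (hsnoc : ∀ τ t c' c'', p τ c' → A.Step c' t c'' → p (τ ++ [t]) c'')
    {τ : List ((α × ℕ) ⊕ CounterOp)} {c' : Q × ℕ} (h : A.PartialRun c τ c') : p τ c' := by
  suffices H : ∀ {c₁ τ' c₂}, A.PartialRun c₁ τ' c₂ → ∀ τ, p τ c₁ → p (τ ++ τ') c₂ from
    H h [] hnil
  intro c₁ τ' c₂ h'
  induction h' with
  | nil => exact fun τ hτ => by simpa using hτ
  | cons hs _ ih => exact fun τ hτ => by simpa using ih _ (hsnoc _ _ _ _ hτ hs)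

end OCA

/-! ### Correctness of the determinized automaton -/

namespace Det

section Det

variable {α : Type*} {s : ℕ} {w : List ℕ} (eα : α ≃ Fin s)

open Classical in
/-- The determinized automaton. -/
noncomputable def det (hi : ini w < nS w) : OCA (Fin (nStates w)) α :=
  letI := Fintype.ofEquiv (Fin s) eα.symm
  { init := ⟨start w, start_lt hi⟩
    final := Finset.univ.filter fun q => (q : ℕ) / 2 ^ nS w / period w = 3
    threshold := bigThr w
    trans := Finset.univ.filter fun t => (t.2.2.2 : ℕ) = delta w t.1 t.2.1 (lab eα t.2.2.1) }

variable {eα} {hi : ini w < nS w}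

theorem mem_det_trans {p q : Fin (nStates w)} {k : Fin ((det eα hi).threshold + 1)}
    {σ : α ⊕ CounterOp} :
    (p, k, σ, q) ∈ (det eα hi).trans ↔ (q : ℕ) = delta w p k (lab eα σ) := by
  let := Fintype.ofEquiv (Fin s) eα.symm
  exact Finset.mem_filter.trans (and_iff_right (Finset.mem_univ _))

theorem mem_det_final {q : Fin (nStates w)} :
    q ∈ (det eα hi).final ↔ (q : ℕ) / 2 ^ nS w / period w = 3 := by
  simp [det]

theorem det_isDeterministic : (det eα hi).IsDeterministic := fun q k σ =>
  ⟨⟨delta w q k (lab eα σ), delta_lt _ _ _⟩, mem_det_trans.2 rfl,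
    fun _ h => Fin.ext (mem_det_trans.1 h)⟩

variable (eα) in
/-- The meaning of a configuration that is reached after the word `u` with visible trace `v`. -/
structure Good (v : List (α ⊕ CounterOp)) (u : List (α × ℕ)) (mode S x : ℕ) : Prop where
  lt : S < 2 ^ nS w
  reach : ∀ q < nS w, Reachable w S x q ↔
    ∃ p, (after w eα u).1 p ∧ ReflTransGen (sys w).Silent (p, (after w eα u).2) (q, x)
  vis : v = enc u ++ opsBetween α (after w eα u).2 x
  inc : mode = 1 → (after w eα u).2 ≤ x
  dec : mode = 2 → x ≤ (after w eα u).2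
  letter : mode ≠ 1 → mode ≠ 2 → x = (after w eα u).2 ∧ (mode = 3 ↔ Accepts w eα u)

variable {v : List (α ⊕ CounterOp)} {u : List (α × ℕ)} {mode S x : ℕ}

theorem exists_reachable (h : Good (w := w) eα v u mode S x)
    {t : ℕ → ℕ → Prop} {q : ℕ} (ht : ∀ p, t p q → p < nS w) :
    (∃ p < nS w, Reachable w S x p ∧ t p q) ↔ ∃ p a, (after w eα u).1 p ∧
      ReflTransGen (sys w).Silent (p, (after w eα u).2) (a, x) ∧ t a q := by
  constructor
  · rintro ⟨a, ha, h1, h2⟩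
    obtain ⟨p, h3, h4⟩ := (h.reach a ha).1 h1
    exact ⟨p, a, h3, h4, h2⟩
  · rintro ⟨p, a, h1, h2, h3⟩
    exact ⟨a, ht a h3, (h.reach a (ht a h3)).2 ⟨p, h1, h2⟩, h3⟩

theorem good_letter (u : List (α × ℕ)) (hi : ini w < nS w) (hS : S < 2 ^ nS w)
    (h : ∀ q, S.testBit q = true ↔ (after w eα u).1 q) :
    Good (w := w) eα (enc u) u (letterMode w S (after w eα u).2) S (after w eα u).2 where
  lt := hS
  reach q hq := by
    simp only [Reachable, h]
    constructor
    · rintro ⟨p, -, h1, h2⟩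
      exact ⟨p, h1, CounterSystem.silent_of_loops h2⟩
    · rintro ⟨p, h1, h2⟩
      have hp := lt_of_after hi h1
      exact ⟨p, hp, h1, (CounterSystem.silent_iff_loops (Nat.lt_succ_of_lt hp)).1 h2⟩
  vis := by simp [opsBetween_self]
  inc _ := le_rfl
  dec _ := le_rfl
  letter _ _ := by
    refine ⟨rfl, ?_⟩
    have : Reachable w S (after w eα u).2 (nS w) ↔ Accepts w eα u := by
      simp only [Reachable, h, Accepts]
      exact ⟨fun ⟨p, _, h1, h2⟩ => ⟨p, h1, h2⟩, fun ⟨p, h1, h2⟩ => ⟨p, lt_of_after hi h1, h1, h2⟩⟩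
    rw [← this, letterMode]
    split_ifs with h <;> simp [h]

theorem Good.read (hi : ini w < nS w) (h : Good (w := w) eα v u mode S x) (a : α) :
    Good (w := w) eα (v ++ [.inl a]) (u ++ [(a, x)])
      (letterMode w (nextSet w S x fun p q => HasTrans w p (min x (thr w)) (eα a) q) x)
      (nextSet w S x fun p q => HasTrans w p (min x (thr w)) (eα a) q) x := by
  have h1 := good_letter (eα := eα) (u ++ [(a, x)]) hi
    (nextSet_lt S x fun p q => HasTrans w p (min x (thr w)) (eα a) q) fun q => by
      rw [testBit_nextSet, after_append, wordStep]
      refine and_congr_right fun hq => exists_congr fun p => and_congr_right fun hp => ?_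
      rw [h.reach p hp]
  rw [after_append] at h1
  rwa [enc_append, ← h.vis] at h1

/-- Outside mode `2` the counter is not below its value at the last letter, so `silent_up_iff`
describes all silent runs to `x + 1`, including those that are not monotone. -/
theorem Good.increment (hi : ini w < nS w) (h : Good (w := w) eα v u mode S x) (hm : mode ≠ 2) :
    Good (w := w) eα (v ++ [.inr .inc]) u 1 (nextSet w S x (Up w x)) (x + 1) := by
  have hx : (after w eα u).2 ≤ x := by
    by_cases h1 : mode = 1
    · exact h.inc h1
    · exact (h.letter h1 hm).1.ge
  refine ⟨nextSet_lt _ _ _, fun q hq => ?_, ?_, fun _ => by omega, fun h => by omega,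
    fun h => absurd rfl h⟩
  · simp only [Reachable, testBit_nextSet]
    constructor
    · rintro ⟨b, -, ⟨hb, h1⟩, h2⟩
      obtain ⟨p, a, h3, h4, h5⟩ := (exists_reachable h fun p hp => by
        unfold Up at hp
        omega).1 h1
      exact ⟨p, h3, (h4.tail (.up h5)).trans (CounterSystem.silent_of_loops h2)⟩
    · rintro ⟨p, h1, h2⟩
      obtain ⟨a, b, h3, h4, h5⟩ :=
        (CounterSystem.silent_up_iff (Nat.lt_succ_of_lt (lt_of_after hi h1)) hx).1 h2
      have hb := lt_of_loops h5 hq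
      exact ⟨b, hb, ⟨hb, (exists_reachable h fun p hp => by
        unfold Up at hp
        omega).2 ⟨p, a, h1, h3, h4⟩⟩, h5⟩
  · rw [opsBetween_inc hx, ← List.append_assoc, ← h.vis]

theorem Good.decrement (hi : ini w < nS w) (h : Good (w := w) eα v u mode S (x + 1))
    (hm : mode ≠ 1) :
    Good (w := w) eα (v ++ [.inr .dec]) u 2 (nextSet w S (x + 1) (Dn w x)) x := by
  have hx : x + 1 ≤ (after w eα u).2 := by
    by_cases h1 : mode = 2
    · exact h.dec h1
    · exact (h.letter hm h1).1.le
  refine ⟨nextSet_lt _ _ _, fun q hq => ?_, ?_, fun h => by omega, fun _ => by omega,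
    fun _ h => absurd rfl h⟩
  · simp only [Reachable, testBit_nextSet]
    constructor
    · rintro ⟨b, -, ⟨hb, h1⟩, h2⟩
      obtain ⟨p, a, h3, h4, h5⟩ := (exists_reachable h fun p hp => by
        unfold Dn at hp
        omega).1 h1
      exact ⟨p, h3, (h4.tail (.dn h5)).trans (CounterSystem.silent_of_loops h2)⟩
    · rintro ⟨p, h1, h2⟩
      obtain ⟨a, b, h3, h4, h5⟩ :=
        (CounterSystem.silent_dn_iff (Nat.lt_succ_of_lt (lt_of_after hi h1)) hx).1 h2
      have hb := lt_of_loops h5 hq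
      exact ⟨b, hb, ⟨hb, (exists_reachable h fun p hp => by
        unfold Dn at hp
        omega).2 ⟨p, a, h1, h3, h4⟩⟩, h5⟩
  · rw [opsBetween_dec hx, ← List.append_assoc, ← h.vis]

variable (eα) in
/-- The configuration `c` has the expected meaning after the word `u` with visible trace `v`. -/
def Tracks (v : List (α ⊕ CounterOp)) (u : List (α × ℕ)) (mode : ℕ)
    (c : Fin (nStates w) × ℕ) : Prop :=
  ∃ S, (c.1 : ℕ) = pack w mode (c.2 % period w) S ∧ Good (w := w) eα v u mode S c.2

/-- The configurations without possible states. -/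
def Dead (c : Fin (nStates w) × ℕ) : Prop :=
  ∃ mode ρ, mode < 3 ∧ ρ < period w ∧ (c.1 : ℕ) = pack w mode ρ 0

theorem delta_of_tracks {c : Fin (nStates w) × ℕ} (h : (c.1 : ℕ) = pack w mode (c.2 % period w) S)
    (hS : S < 2 ^ nS w) (σ : ℕ) :
    delta w c.1 (min c.2 (bigThr w)) σ = next w mode (c.2 % period w) S
      (repr w (min c.2 (bigThr w)) (c.2 % period w)) σ := by
  rw [h, delta_pack (Nat.mod_lt _ period_pos) hS]

theorem reachable_zero (x q : ℕ) : ¬ Reachable w 0 x q := by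
  rintro ⟨p, -, h, -⟩
  simp at h

theorem nextSet_zero (x : ℕ) (t : ℕ → ℕ → Prop) : nextSet w 0 x t = 0 := by
  simp [nextSet, setCode, reachable_zero]

theorem pred_mod (x : ℕ) : ((x + 1) % period w + (period w - 1)) % period w = x % period w := by
  have := period_pos (w := w)
  rw [Nat.mod_add_mod, show x + 1 + (period w - 1) = x + period w by omega, Nat.add_mod_right]

theorem nextSet_repr (S x : ℕ) (t : ℕ → ℕ → Prop) :
    nextSet w S (repr w (min x (bigThr w)) (x % period w)) t = nextSet w S x t := by
  simp only [nextSet, reachable_repr]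

theorem letterMode_repr (S x : ℕ) :
    letterMode w S (repr w (min x (bigThr w)) (x % period w)) = letterMode w S x := by
  classical
  rw [letterMode, letterMode]
  exact if_congr (reachable_repr _ _ _) rfl rfl

section Steps

variable (hs : nL w = s)
include hs

theorem step_letter {c c' : Fin (nStates w) × ℕ} {a : α} {y : ℕ}
    (h : Tracks (w := w) eα v u mode c) (hst : (det eα hi).Step c (.inl (a, y)) c') :
    ∃ mode', mode' ≠ 1 ∧ mode' ≠ 2 ∧
      Tracks (w := w) eα (v ++ [.inl a]) (u ++ [(a, y)]) mode' c' := by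
  obtain ⟨S, hc, hg⟩ := h
  cases hst with
  | @letter q q' x _ ht =>
    have h1 := (mem_det_trans.1 ht).trans (delta_of_tracks (c := (q, y)) hc hg.lt _)
    have hlt : (eα a : ℕ) < nL w := hs ▸ (eα a).2
    simp only [lab, next, if_pos hlt, nextSet_repr, letterState, letterMode_repr,
      min_repr_thr] at h1
    refine ⟨_, ?_, ?_, _, h1, hg.read hi a⟩ <;>
    · rw [letterMode]
      split_ifs <;> omega

theorem step_inc {c c' : Fin (nStates w) × ℕ} (h : Tracks (w := w) eα v u mode c) (hm : mode ≠ 2)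
    (hst : (det eα hi).Step c (.inr .inc) c') :
    Tracks (w := w) eα (v ++ [.inr .inc]) u 1 c' := by
  obtain ⟨S, hc, hg⟩ := h
  cases hst with
  | @inc q q' x ht =>
    have h1 := (mem_det_trans.1 ht).trans (delta_of_tracks (c := (q, x)) hc hg.lt _)
    simp only [lab, next, hs, lt_irrefl, if_false, if_true, if_neg hm, nextSet_repr, up_repr,
      Nat.mod_add_mod] at h1
    exact ⟨_, h1, hg.increment hi hm⟩

theorem step_dec {c c' : Fin (nStates w) × ℕ} (h : Tracks (w := w) eα v u mode c) (hm : mode ≠ 1)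
    (hst : (det eα hi).Step c (.inr .dec) c') :
    Tracks (w := w) eα (v ++ [.inr .dec]) u 2 c' := by
  obtain ⟨S, hc, hg⟩ := h
  cases hst with
  | @dec q q' x ht =>
    have h1 := (mem_det_trans.1 ht).trans (delta_of_tracks (c := (q, x + 1)) hc hg.lt _)
    simp only [lab, next, hs, show ¬ s + 1 < s by omega, show ¬ s + 1 = s by omega, if_false,
      if_neg hm, nextSet_repr, dn_repr, pred_mod] at h1
    exact ⟨_, h1, hg.decrement hi hm⟩

/-- From the empty set nothing is reachable: it stays empty, and a letter leads to mode `0`, never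
to the accepting mode `3`. -/
theorem step_dead {c c' : Fin (nStates w) × ℕ} {t : (α × ℕ) ⊕ CounterOp} (h : Dead c)
    (hst : (det eα hi).Step c t c') : Dead c' := by
  obtain ⟨mode, ρ, hm, hρ, hc⟩ := h
  have hlt : ∀ a, (eα a : ℕ) < nL w := fun a => hs ▸ (eα a).2
  have hL := period_pos (w := w)
  have h0 : (0 : ℕ) < 2 ^ nS w := by positivity
  have h1 : ¬ s + 1 < s := by omega
  cases hst with
  | letter ht =>
    have h1 := mem_det_trans.1 ht
    simp only [] at hc
    rw [hc, delta_pack hρ h0, lab, next, if_pos (hlt _), nextSet_zero, letterState, letterMode,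
      if_neg (reachable_zero _ _)] at h1
    exact ⟨_, _, by omega, hρ, h1⟩
  | inc ht =>
    have h1 := mem_det_trans.1 ht
    simp only [] at hc
    rw [hc, delta_pack hρ h0, lab, next, if_neg (by omega), if_pos hs.symm, nextSet_zero,
      ite_self] at h1
    exact ⟨_, _, by omega, Nat.mod_lt _ hL, h1⟩
  | dec ht =>
    have h1 := mem_det_trans.1 ht
    simp only [] at hc
    rw [hc, delta_pack hρ h0, lab, next, if_neg (by omega), if_neg (by omega), nextSet_zero,
      ite_self] at h1
    exact ⟨_, _, by omega, Nat.mod_lt _ hL, h1⟩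

theorem step_inc_dead {c c' : Fin (nStates w) × ℕ} (h : Tracks (w := w) eα v u 2 c)
    (hst : (det eα hi).Step c (.inr .inc) c') : Dead c' := by
  obtain ⟨S, hc, hg⟩ := h
  cases hst with
  | @inc q q' x ht =>
    have h1 := (mem_det_trans.1 ht).trans (delta_of_tracks (c := (q, x)) hc hg.lt _)
    rw [lab, next, if_neg (by omega), if_pos hs.symm, if_pos rfl] at h1
    exact ⟨_, _, by omega, Nat.mod_lt _ period_pos, h1⟩

theorem step_dec_dead {c c' : Fin (nStates w) × ℕ} (h : Tracks (w := w) eα v u 1 c)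
    (hst : (det eα hi).Step c (.inr .dec) c') : Dead c' := by
  obtain ⟨S, hc, hg⟩ := h
  cases hst with
  | @dec q q' x ht =>
    have h1 := (mem_det_trans.1 ht).trans (delta_of_tracks (c := (q, x + 1)) hc hg.lt _)
    rw [lab, next, if_neg (by omega), if_neg (by omega), if_pos rfl] at h1
    exact ⟨_, _, by omega, Nat.mod_lt _ period_pos, h1⟩

omit hs in
theorem tracks_init : ∃ mode, mode ≠ 1 ∧ mode ≠ 2 ∧
    Tracks (w := w) eα [] [] mode ((det eα hi).init, 0) := by
  refine ⟨letterMode w (2 ^ ini w) 0, ?_, ?_, 2 ^ ini w, ?_, ?_⟩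
  · rw [letterMode]
    split_ifs <;> omega
  · rw [letterMode]
    split_ifs <;> omega
  · simp [det, start, letterState]
  · refine good_letter [] hi (Nat.pow_lt_pow_right (by omega) hi) fun q => ?_
    rw [Nat.testBit_two_pow]
    simp [after, eq_comm]

theorem tracks_or_dead {τ : List ((α × ℕ) ⊕ CounterOp)} {c : Fin (nStates w) × ℕ}
    (h : (det eα hi).PartialRun ((det eα hi).init, 0) τ c) :
    (∃ mode, Tracks (w := w) eα (visTrace τ) (obsTrace τ) mode c) ∨ Dead c := by
  refine OCA.PartialRun.snoc_induction (p := fun τ c =>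
    (∃ mode, Tracks (w := w) eα (visTrace τ) (obsTrace τ) mode c) ∨ Dead c) ?_ ?_ h
  · obtain ⟨mode, -, -, h⟩ := tracks_init (eα := eα) (hi := hi)
    exact .inl ⟨mode, h⟩
  · rintro τ t c c' (⟨mode, h⟩ | h) hst
    · rcases t with ⟨a, y⟩ | _ | _
      · obtain ⟨mode', -, -, h'⟩ := step_letter hs h hst
        left
        exact ⟨mode', by simpa [visTrace, obsTrace] using h'⟩
      · by_cases hm : mode = 2
        · subst hm
          exact .inr (step_inc_dead hs h hst)
        · left
          exact ⟨1, by simpa [visTrace, obsTrace, List.filterMap_cons] using step_inc hs h hm hst⟩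
      · by_cases hm : mode = 1
        · subst hm
          exact .inr (step_dec_dead hs h hst)
        · left
          exact ⟨2, by simpa [visTrace, obsTrace, List.filterMap_cons] using step_dec hs h hm hst⟩
    · exact .inr (step_dead hs h hst)

/-- Mode `3` excludes dead configurations. It also forces the counter to have its value at the last
letter, so that no operations follow the encoding. -/
theorem accepts_of_acceptsTrace {τ : List ((α × ℕ) ⊕ CounterOp)}
    (h : (det eα hi).AcceptsTrace τ) :
    Accepts w eα (obsTrace τ) ∧ visTrace τ = enc (obsTrace τ) := by
  obtain ⟨q, x, hr, hq⟩ := h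
  rw [mem_det_final] at hq
  rcases tracks_or_dead hs hr with ⟨mode, S, hc, hg⟩ | ⟨mode, ρ, hm, hρ, hc⟩
  · simp only [] at hc hg
    rw [hc, pack_div_div (Nat.mod_lt _ period_pos) hg.lt] at hq
    subst hq
    obtain ⟨h1, h2⟩ := hg.letter (by omega) (by omega)
    refine ⟨h2.1 rfl, ?_⟩
    rw [hg.vis, ← h1, opsBetween_self, List.append_nil]
  · simp only [] at hc
    rw [hc, pack_div_div hρ (by positivity)] at hq
    omega

theorem exists_incs (u : List (α × ℕ)) (d : ℕ) {v : List (α ⊕ CounterOp)} {mode : ℕ}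
    {c : Fin (nStates w) × ℕ} (h : Tracks (w := w) eα v u mode c) (hm : mode ≠ 2) :
    ∃ τ v' q mode', (det eα hi).PartialRun c τ (q, c.2 + d) ∧ obsTrace τ = [] ∧
      Tracks (w := w) eα v' u mode' (q, c.2 + d) := by
  induction d generalizing v mode c with
  | zero => exact ⟨[], v, c.1, mode, .nil _, rfl, h⟩
  | succ d ih =>
    obtain ⟨q, hq, -⟩ := det_isDeterministic (eα := eα) (hi := hi) c.1 ((det eα hi).test c.2)
      (.inr .inc)
    have hst : (det eα hi).Step c (.inr .inc) (q, c.2 + 1) := .inc hq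
    obtain ⟨τ, v', q', mode', h1, h2, h3⟩ := ih (step_inc hs h hm hst) (by omega)
    rw [show (q, c.2 + 1).2 + d = c.2 + (d + 1) by simp only []; omega] at h1 h3
    exact ⟨_, v', q', mode', .cons hst h1, by simpa [obsTrace] using h2, h3⟩

theorem exists_decs (u : List (α × ℕ)) (d y : ℕ) {v : List (α ⊕ CounterOp)} {mode : ℕ}
    {q₀ : Fin (nStates w)} (h : Tracks (w := w) eα v u mode (q₀, y + d)) (hm : mode ≠ 1) :
    ∃ τ v' q mode', (det eα hi).PartialRun (q₀, y + d) τ (q, y) ∧ obsTrace τ = [] ∧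
      Tracks (w := w) eα v' u mode' (q, y) := by
  induction d generalizing v mode q₀ with
  | zero => exact ⟨[], v, q₀, mode, .nil _, rfl, h⟩
  | succ d ih =>
    obtain ⟨q, hq, -⟩ := det_isDeterministic (eα := eα) (hi := hi) q₀
      ((det eα hi).test (y + d + 1)) (.inr .dec)
    have hst : (det eα hi).Step (q₀, y + d + 1) (.inr .dec) (q, y + d) := .dec hq
    obtain ⟨τ, v', q', mode', h1, h2, h3⟩ := ih (step_dec hs h hm hst) (by omega)
    exact ⟨_, v', q', mode', .cons hst h1, by simpa [obsTrace] using h2, h3⟩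

/-- Every label has a successor, so the automaton can be driven monotonically from each observed
counter value to the next one. -/
theorem exists_run (u : List (α × ℕ)) : ∃ τ v q mode, mode ≠ 1 ∧ mode ≠ 2 ∧
    (det eα hi).PartialRun ((det eα hi).init, 0) τ (q, (after w eα u).2) ∧ obsTrace τ = u ∧
      Tracks (w := w) eα v u mode (q, (after w eα u).2) := by
  induction u using List.reverseRecOn with
  | nil =>
    obtain ⟨mode, h1, h2, h3⟩ := tracks_init (eα := eα) (hi := hi)
    exact ⟨[], [], _, mode, h1, h2, .nil _, rfl, h3⟩
  | append_singleton u l ih =>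
    obtain ⟨τ, v, q, mode, h1, h2, h3, h4, h5⟩ := ih
    obtain ⟨a, y⟩ := l
    have hy : (after w eα (u ++ [(a, y)])).2 = y := by
      rw [after_append, wordStep]
    obtain ⟨τ', v', q', mode', g1, g2, g3⟩ : ∃ τ' v' q' mode',
        (det eα hi).PartialRun (q, (after w eα u).2) τ' (q', y) ∧ obsTrace τ' = [] ∧
          Tracks (w := w) eα v' u mode' (q', y) := by
      rcases le_total (after w eα u).2 y with hle | hle
      · obtain ⟨d, hd⟩ := Nat.exists_eq_add_of_le hle
        rw [hd]
        exact exists_incs hs u d h5 h2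
      · obtain ⟨d, hd⟩ := Nat.exists_eq_add_of_le hle
        rw [hd] at h5 ⊢
        exact exists_decs hs u d y h5 h1
    obtain ⟨q'', hq, -⟩ := det_isDeterministic (eα := eα) (hi := hi) q'
      ((det eα hi).test y) (.inl a)
    have hst : (det eα hi).Step (q', y) (.inl (a, y)) (q'', y) := .letter hq
    obtain ⟨mode'', k1, k2, k3⟩ := step_letter hs g3 hst
    rw [hy]
    refine ⟨τ ++ (τ' ++ [.inl (a, y)]), _, q'', mode'', k1, k2, h3.append (g1.snoc hst), ?_, k3⟩
    rw [obsTrace, List.filterMap_append, List.filterMap_append, ← obsTrace, ← obsTrace, h4, g2]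
    rfl

theorem det_Lobs : (det eα hi).Lobs = {u | Accepts w eα u} := by
  ext u
  constructor
  · rintro ⟨τ, h, rfl⟩
    exact (accepts_of_acceptsTrace hs h).1
  · intro h
    obtain ⟨τ, v, q, mode, h1, h2, h3, h4, S, hc, hg⟩ := exists_run (hi := hi) hs u
    refine ⟨τ, ⟨q, _, h3, ?_⟩, h4⟩
    simp only [] at hc
    rw [mem_det_final, hc, pack_div_div (Nat.mod_lt _ period_pos) hg.lt]
    exact (hg.letter h1 h2).2.2 h

theorem det_Lvis : (det eα hi).Lvis ≤ Encs α := by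
  rintro v ⟨τ, h, rfl⟩
  exact ⟨_, (accepts_of_acceptsTrace hs h).2.symm⟩

end Steps

end Det

end Det

/-! ### Reading an encoded automaton -/

theorem List.length_flatMap_const {ι β : Type*} {f : ι → List β} {k : ℕ}
    (hf : ∀ a, (f a).length = k) (l : List ι) : (l.flatMap f).length = l.length * k := by
  induction l with
  | nil => simp
  | cons a l ih =>
    rw [List.flatMap_cons, List.length_append, ih, hf, List.length_cons]
    ring

theorem List.getD_flatMap_const {ι β : Type*} {f : ι → List β} {k : ℕ}
    (hf : ∀ a, (f a).length = k) (d : β) (l : List ι) (i : ℕ) (hi : i < l.length) (j : ℕ)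
    (hj : j < k) : (l.flatMap f).getD (i * k + j) d = (f l[i]).getD j d := by
  induction l generalizing i with
  | nil => simp at hi
  | cons a l ih =>
    rw [List.flatMap_cons]
    cases i with
    | zero =>
      rw [zero_mul, zero_add, List.getD_append _ _ _ _ (by rwa [hf])]
      rfl
    | succ i =>
      have h : k ≤ (i + 1) * k + j := by nlinarith
      rw [List.getD_append_right _ _ _ _ (by rwa [hf]), hf,
        show (i + 1) * k + j - k = i * k + j by
          rw [Nat.add_mul]
          omega]
      exact ih i (by simpa using hi)

namespace Det

variable {Q α : Type*} {n s : ℕ} {eQ : Q ≃ Fin n} {eα : α ≃ Fin s} {A : OCA Q α}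

theorem length_labelList (eα : α ≃ Fin s) : (labelList eα).length = s + 2 := by
  simp [labelList]

theorem lab_lt (eα : α ≃ Fin s) (σ : α ⊕ CounterOp) : lab eα σ < (labelList eα).length := by
  rw [length_labelList]
  rcases σ with a | _ | _ <;> simp only [lab] <;> omega

theorem labelList_getElem (eα : α ≃ Fin s) (σ : α ⊕ CounterOp) :
    (labelList eα)[lab eα σ]'(lab_lt eα σ) = σ := by
  rcases σ with a | _ | _ <;> simp [lab, labelList]

/-- The list `w` describes the automaton `A`. -/
structure Codes (w : List ℕ) (A : OCA Q α) (eQ : Q ≃ Fin n) (eα : α ≃ Fin s) : Prop where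
  nS_eq : nS w = n
  nL_eq : nL w = s
  thr_eq : thr w = A.threshold
  ini_eq : ini w = eQ A.init
  final_iff : ∀ q, IsFinal w (eQ q) ↔ q ∈ A.final
  trans_iff : ∀ (p : Q) (k : Fin (A.threshold + 1)) (σ : α ⊕ CounterOp) (q : Q),
    HasTrans w (eQ p) k (lab eα σ) (eQ q) ↔ (p, k, σ, q) ∈ A.trans

theorem codes_encode (A : OCA Q α) (eQ : Q ≃ Fin n) (eα : α ≃ Fin s) :
    Codes (A.encode eQ eα) A eQ eα := by
  classical
  have h0 : nS (A.encode eQ eα) = n := rfl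
  have h1 : nL (A.encode eQ eα) = s := rfl
  have h2 : thr (A.encode eQ eα) = A.threshold := rfl
  refine ⟨h0, h1, h2, rfl, fun q => ?_, fun p k σ q => ?_⟩
  · rw [IsFinal, OCA.encode, List.append_assoc, List.getD_append_right _ _ _ _ (by simp),
      List.getD_append _ _ _ _ (by simp)]
    simp
  · rw [HasTrans, h0, h1, h2, OCA.encode, List.getD_append_right _ _ _ _ (by
      simp only [List.length_append, List.length_map, List.length_finRange, List.length_cons,
        List.length_nil]
      omega)]
    -- The Horner form is regrouped so that every nested `flatMap` splits off one digit of the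
    -- position.
    have e : 4 + n + ((((eQ p : ℕ) * (A.threshold + 1) + k) * (s + 2) + lab eα σ) * n + eQ q) -
        (4 + n) = (eQ p : ℕ) * ((A.threshold + 1) * ((s + 2) * n)) +
          ((k : ℕ) * ((s + 2) * n) + (lab eα σ * n + eQ q)) := by
      rw [Nat.add_sub_cancel_left]
      ring
    have l1 : lab eα σ * n + eQ q < (s + 2) * n := by
      have := lab_lt eα σ
      rw [length_labelList] at this
      nlinarith [(eQ q).2]
    have l2 : (k : ℕ) * ((s + 2) * n) + (lab eα σ * n + eQ q) <
        (A.threshold + 1) * ((s + 2) * n) := by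
      have := Nat.mul_le_mul_right ((s + 2) * n) k.2
      rw [Nat.succ_eq_add_one, Nat.add_mul, one_mul] at this
      omega
    have c1 (p : Fin n) (k : Fin (A.threshold + 1)) (σ : α ⊕ CounterOp) :
        ((List.finRange n).map fun q =>
          if (eQ.symm p, k, σ, eQ.symm q) ∈ A.trans then 1 else 0).length = n := by simp
    have c2 (p : Fin n) (k : Fin (A.threshold + 1)) :=
      List.length_flatMap_const (c1 p k) (labelList eα)
    simp only [length_labelList] at c2
    have c3 (p : Fin n) := List.length_flatMap_const (c2 p) (List.finRange (A.threshold + 1))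
    simp only [List.length_finRange] at c3
    simp only [List.length_append, List.length_map, List.length_finRange, List.length_cons,
        List.length_nil]
    rw [show 0 + 1 + 1 + 1 + 1 + n = 4 + n by omega, e,
      List.getD_flatMap_const c3 _ _ _ (by simp) _ l2,
      List.getD_flatMap_const (c2 _) _ _ _ (by simpa using Nat.le_of_lt_succ k.2) _ l1,
      List.getD_flatMap_const (c1 _ _) _ _ _ (lab_lt eα σ) _ (eQ q).2]
    simp [labelList_getElem]

theorem getD_encode_le [Fintype Q] [Fintype α] (A : OCA Q α) (eQ : Q ≃ Fin n) (eα : α ≃ Fin s)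
    (i : ℕ) : (A.encode eQ eα).getD i 0 ≤ A.size := by
  classical
  have hn : Fintype.card Q = n := by simpa using Fintype.card_congr eQ
  have hs : Fintype.card α = s := by simpa using Fintype.card_congr eα
  have hi := (eQ A.init).2
  have hall : ∀ a ∈ A.encode eQ eα, a ≤ A.size := by
    intro a ha
    rw [OCA.size, hn, hs]
    simp only [OCA.encode, List.mem_append, List.mem_cons, List.not_mem_nil, or_false,
      List.mem_map, List.mem_flatMap] at ha
    rcases ha with ((rfl | rfl | rfl | rfl) | ⟨q, -, rfl⟩) | ⟨p, -, k, -, σ, -, q, -, rfl⟩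
    · omega
    · omega
    · omega
    · omega
    · split_ifs <;> omega
    · split_ifs <;> omega
  rcases lt_or_ge i (A.encode eQ eα).length with h | h
  · rw [List.getD_eq_getElem _ _ h]
    exact hall _ (List.getElem_mem h)
  · rw [List.getD_eq_default _ _ h]
    exact Nat.zero_le _

/-! ### The language of the encoded automaton -/

section Semantics

variable {w : List ℕ} (hw : Codes w A eQ eα)
include hw

theorem lt_nS (q : Q) : (eQ q : ℕ) < nS w := hw.nS_eq ▸ (eQ q).2

theorem exists_eQ {p : ℕ} (hp : p < nS w) : ∃ q, (eQ q : ℕ) = p :=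
  ⟨eQ.symm ⟨p, hw.nS_eq ▸ hp⟩, by simp⟩

theorem hasTrans_test_iff (p q : Q) (x : ℕ) (σ : α ⊕ CounterOp) :
    HasTrans w (eQ p) (min x (thr w)) (lab eα σ) (eQ q) ↔ (p, A.test x, σ, q) ∈ A.trans := by
  rw [← hw.trans_iff, OCA.test, hw.thr_eq]

theorem up_iff (p q : Q) (x : ℕ) :
    Up w x (eQ p) (eQ q) ↔ (p, A.test x, .inr .inc, q) ∈ A.trans := by
  have h1 := lt_nS hw p
  have h2 := lt_nS hw q
  rw [← hasTrans_test_iff hw, Up, lab, hw.nL_eq]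
  constructor
  · rintro (⟨-, -, h⟩ | ⟨-, h⟩)
    · exact h
    · omega
  · exact fun h => .inl ⟨h1, h2, h⟩

theorem dn_iff (p q : Q) (x : ℕ) :
    Dn w x (eQ p) (eQ q) ↔ (p, A.test (x + 1), .inr .dec, q) ∈ A.trans := by
  have h1 := lt_nS hw p
  have h2 := lt_nS hw q
  rw [← hasTrans_test_iff hw, Dn, lab, hw.nL_eq]
  constructor
  · rintro (⟨-, -, h⟩ | ⟨-, h⟩)
    · exact h
    · omega
  · exact fun h => .inl ⟨h1, h2, h⟩

/-- The statement is about an arbitrary starting pair `C` because runs are built from the front,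
while the fold over the letters consumes them from the front as well. -/
theorem exists_after_of_run {c c' : Q × ℕ} {τ : List ((α × ℕ) ⊕ CounterOp)}
    (h : A.PartialRun c τ c') : ∀ C : (ℕ → Prop) × ℕ,
      (∃ p, C.1 p ∧ ReflTransGen (sys w).Silent (p, C.2) ((eQ c.1 : ℕ), c.2)) →
      ∃ p, ((obsTrace τ).foldl (wordStep w eα) C).1 p ∧ ReflTransGen (sys w).Silent
        (p, ((obsTrace τ).foldl (wordStep w eα) C).2) ((eQ c'.1 : ℕ), c'.2) := by
  induction h with
  | nil => exact fun _ h => h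
  | cons hst _ ih =>
    rintro C ⟨p, hp, hr⟩
    cases hst with
    | inc ht => exact ih C ⟨p, hp, hr.tail (.up ((up_iff hw _ _ _).2 ht))⟩
    | dec ht => exact ih C ⟨p, hp, hr.tail (.dn ((dn_iff hw _ _ _).2 ht))⟩
    | @letter q q' x a ht =>
      exact ih (wordStep w eα C (a, x)) ⟨eQ q', ⟨lt_nS hw _, eQ q, lt_nS hw _, ⟨p, hp, hr⟩,
        (hasTrans_test_iff hw q q' x (.inl a)).2 ht⟩, .refl⟩

theorem exists_run_of_silent {q : Q} {x : ℕ} {c : ℕ × ℕ}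
    (h : ReflTransGen (sys w).Silent ((eQ q : ℕ), x) c) (hc : c.1 < nS w) :
    ∃ τ q', A.PartialRun (q, x) τ (q', c.2) ∧ (eQ q' : ℕ) = c.1 ∧ obsTrace τ = [] := by
  induction h with
  | refl => exact ⟨[], q, .nil _, rfl, rfl⟩
  | tail _ hst ih =>
    cases hst with
    | @up y p p' hu =>
      have hp : p < nS w := by
        have hu : Up w y p p' := hu
        simp only [Up] at hu hc
        omega
      obtain ⟨τ, q₁, h1, h2, h3⟩ := ih hp
      obtain ⟨q₂, rfl⟩ := exists_eQ hw hc
      simp only [] at h2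
      subst h2
      exact ⟨_, q₂, h1.snoc (.inc ((up_iff hw _ _ _).1 hu)), rfl, by
        simpa [obsTrace, List.filterMap_cons] using h3⟩
    | @dn y p p' hu =>
      have hp : p < nS w := by
        have hu : Dn w y p p' := hu
        simp only [Dn] at hu hc
        omega
      obtain ⟨τ, q₁, h1, h2, h3⟩ := ih hp
      obtain ⟨q₂, rfl⟩ := exists_eQ hw hc
      simp only [] at h2
      subst h2
      exact ⟨_, q₂, h1.snoc (.dec ((dn_iff hw _ _ _).1 hu)), rfl, by
        simpa [obsTrace, List.filterMap_cons] using h3⟩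

/-- The run is cut at the step that enters `nS w`, which is an increment out of a final state; the
part before it lies in the original automaton. -/
theorem exists_final_run_of_silent {q : Q} {x : ℕ} {c : ℕ × ℕ}
    (h : ReflTransGen (sys w).Silent ((eQ q : ℕ), x) c) (hc : c.1 = nS w) :
    ∃ τ f y, A.PartialRun (q, x) τ (f, y) ∧ f ∈ A.final ∧ obsTrace τ = [] := by
  induction h with
  | refl => exact absurd hc (lt_nS hw q).ne
  | tail hr hst ih =>
    cases hst with
    | @up y p p' hu =>
      have hu : Up w y p p' := hu
      by_cases hp : p = nS w
      · exact ih hp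
      · have h1 : p < nS w ∧ IsFinal w p := by
          simp only [Up] at hu hc
          rcases hu with ⟨_, h, -⟩ | ⟨h | h, -⟩
          · omega
          · exact absurd h hp
          · exact h
        obtain ⟨τ, f, h2, h3, h4⟩ := exists_run_of_silent hw hr h1.1
        simp only [] at h3
        subst h3
        exact ⟨τ, f, y, h2, (hw.final_iff f).1 h1.2, h4⟩
    | @dn y p p' hu =>
      have hu : Dn w y p p' := hu
      refine ih ?_
      simp only [Dn] at hu hc ⊢
      omega

theorem exists_run_of_after (u : List (α × ℕ)) {p : ℕ} (h : (after w eα u).1 p) :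
    ∃ τ q, A.PartialRun (A.init, 0) τ (q, (after w eα u).2) ∧ (eQ q : ℕ) = p ∧
      obsTrace τ = u := by
  induction u using List.reverseRecOn generalizing p with
  | nil => exact ⟨[], A.init, .nil _, hw.ini_eq.symm.trans (show p = ini w from h).symm, rfl⟩
  | append_singleton u l ih =>
    obtain ⟨a, y⟩ := l
    rw [after_append] at h ⊢
    obtain ⟨hp, p', hp', ⟨p₀, h0, hr⟩, ht⟩ := h
    obtain ⟨τ, q₀, h1, rfl, h3⟩ := ih h0
    obtain ⟨τ', q', h4, h5, h6⟩ := exists_run_of_silent hw hr hp'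
    obtain ⟨q, rfl⟩ := exists_eQ hw hp
    simp only [] at h5
    subst h5
    refine ⟨τ ++ (τ' ++ [.inl (a, y)]), q, h1.append (h4.snoc (.letter ?_)), rfl, ?_⟩
    · exact (hasTrans_test_iff hw q' q y (.inl a)).1 ht
    · rw [obsTrace, List.filterMap_append, List.filterMap_append, ← obsTrace, ← obsTrace, h3, h6]
      rfl

omit hw in
theorem silent_top_top (x y : ℕ) : ReflTransGen (sys w).Silent (nS w, x) (nS w, y) := by
  have hup (x : ℕ) : (sys w).Silent (nS w, x) (nS w, x + 1) := .up (.inr ⟨.inl rfl, rfl⟩)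
  have hdn (x : ℕ) : (sys w).Silent (nS w, x + 1) (nS w, x) := .dn (.inr ⟨rfl, rfl⟩)
  have h0 (x : ℕ) : ReflTransGen (sys w).Silent (nS w, x) (nS w, 0) := by
    induction x with
    | zero => exact .refl
    | succ x ih => exact .head (hdn x) ih
  have h1 (x : ℕ) : ReflTransGen (sys w).Silent (nS w, 0) (nS w, x) := by
    induction x with
    | zero => exact .refl
    | succ x ih => exact .tail ih (hup x)
  exact (h0 x).trans (h1 y)

theorem ini_lt : ini w < nS w := by
  rw [hw.ini_eq]
  exact lt_nS hw _

theorem Lobs_eq : A.Lobs = {u | Accepts w eα u} := by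
  ext u
  constructor
  · rintro ⟨τ, ⟨q, x, hr, hq⟩, rfl⟩
    obtain ⟨p, hp, hs⟩ := exists_after_of_run hw hr (fun q => q = ini w, 0)
      ⟨ini w, rfl, hw.ini_eq ▸ .refl⟩
    refine ⟨p, hp, (CounterSystem.silent_iff_loops
      (Nat.lt_succ_of_lt (lt_of_after (ini_lt hw) hp))).1 ?_⟩
    -- From the final state the absorbing state is entered, which then restores the counter value of
    -- the last letter.
    refine (hs.tail (.up (q := nS w) ?_)).trans (silent_top_top _ _)
    exact .inr ⟨.inr ⟨lt_nS hw _, (hw.final_iff q).2 hq⟩, rfl⟩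
  · rintro ⟨p, hp, hl⟩
    obtain ⟨τ, q, h1, rfl, h2⟩ := exists_run_of_after hw u hp
    obtain ⟨τ', f, y, h3, h4, h5⟩ :=
      exists_final_run_of_silent hw (CounterSystem.silent_of_loops hl) rfl
    refine ⟨τ ++ τ', ⟨f, y, h1.append h3, h4⟩, ?_⟩
    rw [obsTrace, List.filterMap_append, ← obsTrace, ← obsTrace, h2, h5, List.append_nil]

end Semantics

end Det

/-! ### Recurrences for the codes of the loops -/

namespace CounterSystem

variable (K : CounterSystem)

/-- The recursion is put into a form that a program can carry out: it uses only codes and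
quantifiers bounded by `v`. Nothing is lost, as all relations involved live on the states below `v`.
-/
theorem relCode_above_succ (h x : ℕ) : relCode K.v (K.above (h + 1) x) =
    relCode K.v (ReflTransGen (relOf K.v (relCode K.v fun p q => ∃ a < K.v, ∃ b < K.v,
      K.up x p a ∧ relOf K.v (relCode K.v (K.above h (x + 1))) a b ∧ K.dn x b q))) := by
  refine relCode_congr fun p hp q _ => ?_
  rw [above, and_iff_right hp]
  suffices H : (fun a b => ∃ c d, K.up x a c ∧ K.above h (x + 1) c d ∧ K.dn x d b) = relOf K.v
      (relCode K.v fun p q => ∃ a < K.v, ∃ b < K.v,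
        K.up x p a ∧ relOf K.v (relCode K.v (K.above h (x + 1))) a b ∧ K.dn x b q) by
    rw [H]
  funext a b
  simp only [relOf_relCode]
  refine propext ⟨?_, ?_⟩
  · rintro ⟨c, d, h1, h2, h3⟩
    have h4 := above_lt h2
    exact ⟨(K.up_lt h1).1, (K.dn_lt h3).2, c, h4.1, d, h4.2, h1, ⟨h4.1, h4.2, h2⟩, h3⟩
  · rintro ⟨-, -, c, -, d, -, h1, ⟨-, -, h2⟩, h3⟩
    exact ⟨c, d, h1, h2, h3⟩

theorem relCode_loops_succ (x : ℕ) : relCode K.v (K.loops (x + 1)) = relCode K.v fun p q =>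
    relOf K.v (relCode K.v (K.peak (x + 1))) p q ∨ ∃ a < K.v, ∃ d < K.v,
      (∃ a' < K.v, relOf K.v (relCode K.v (K.peak (x + 1))) p a' ∧ K.dn x a' a) ∧
      (∃ d' < K.v, K.up x d d' ∧ relOf K.v (relCode K.v (K.peak (x + 1))) d' q) ∧
        relOf K.v (relCode K.v (K.loops x)) a d := by
  refine relCode_congr fun p hp q hq => ?_
  simp only [loops, relOf_relCode]
  refine or_congr ⟨fun h => ⟨hp, hq, h⟩, fun h => h.2.2⟩ ⟨?_, ?_⟩
  · rintro ⟨a, d, ⟨a', h1, h2⟩, ⟨d', h3, h4⟩, h5⟩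
    have h6 := loops_lt h5
    have h7 := (peak_lt h1).2
    have h8 := (peak_lt h4).1
    exact ⟨a, h6.1, d, h6.2, ⟨a', h7, ⟨hp, h7, h1⟩, h2⟩, ⟨d', h8, h3, h8, hq, h4⟩, h6.1, h6.2, h5⟩
  · rintro ⟨a, -, d, -, ⟨a', -, ⟨-, -, h1⟩, h2⟩, ⟨d', -, h3, -, -, h4⟩, -, -, h5⟩
    exact ⟨a, d, ⟨a', h1, h2⟩, ⟨d', h3, h4⟩, h5⟩

end CounterSystem

theorem relCode_walk_succ (v c k : ℕ) :
    relCode v (fun p q => ∃ j ≤ k + 1, Walk (relOf v c) j p q) = relCode v fun p q =>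
      p = q ∨ ∃ t < v, relOf v c p t ∧
        relOf v (relCode v fun p q => ∃ j ≤ k, Walk (relOf v c) j p q) t q := by
  refine relCode_congr fun p hp q hq => ?_
  simp only [relOf_relCode]
  constructor
  · rintro ⟨j, hj, h⟩
    cases j with
    | zero => exact .inl h
    | succ j =>
      obtain ⟨t, h1, h2⟩ := h
      exact .inr ⟨t, h1.2.1, h1, h1.2.1, hq, j, by omega, h2⟩
  · rintro (rfl | ⟨t, -, h1, -, -, j, hj, h2⟩)
    · exact ⟨0, by omega, rfl⟩
    · exact ⟨j + 1, by omega, t, h1, h2⟩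

namespace RAM.Ctx

variable {C : Ctx}

/-! ### Computing the determinized automaton -/

theorem Comp.relCode_of {v : C.Γ → ℕ} {r : C.Γ → ℕ → ℕ → Prop} (hv : C.Comp v)
    (hb : C.PolyBounded v)
    (hr : ∀ p q : (C.push fun γ => v γ * v γ).Γ → ℕ, Ctx.Comp _ p → Ctx.Comp _ q →
      Ctx.Dec (C.push fun γ => v γ * v γ) fun x => r x.1 (p x) (q x)) :
    C.Comp fun γ => relCode (v γ) (r γ) := by
  have hi : (C.push fun γ => v γ * v γ).Comp fun x => (x.2 : ℕ) := .index (hv.mul hv).1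
  exact .relCode hv hb (hr _ _ (hi.div hv.push) (hi.mod hv.push))

/-- The recursion runs over the admitted length of walks; length `v` is enough for the full closure.
-/
theorem Comp.closure {v c : C.Γ → ℕ} (hv : C.Comp v) (hb : C.PolyBounded v) (hc : C.Comp c) :
    C.Comp fun γ => relCode (v γ) (ReflTransGen (relOf (v γ) (c γ))) := by
  refine (Comp.loop (acc := fun γ k => relCode (v γ) fun p q =>
    ∃ j ≤ k, Walk (relOf (v γ) (c γ)) j p q) hv ?_ (.relCode hb.push) fun h => ?_).congr
      fun γ => relCode_congr fun p _ q _ => (reflTransGen_iff_walk_le (s := Finset.range (v γ))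
        (fun a b h => ⟨Finset.mem_range.2 h.1, Finset.mem_range.2 h.2.1⟩) (by simp)).symm
  · exact (Comp.relCode_of (r := fun _ p q => p = q) hv hb fun p q hp hq => .eq hp hq).congr
      fun γ => relCode_congr fun p _ q _ => by simp [Walk]
  · refine Comp.congr ?_ fun x => (relCode_walk_succ _ _ _).symm
    have hv' := hv.push (n := v)
    refine Comp.relCode_of hv'.learn hb.push.learn fun p q hp hq => ?_
    exact (Dec.eq hp hq).or <| .exists_lt hv'.learn.push <|
      (Dec.relOf hv'.learn.push.push hb.push.learn.push.push hc.push.learn.push.push hp.push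
        (.index hv'.learn.push.1)).and
      (Dec.relOf hv'.learn.push.push hb.push.learn.push.push h.push.push
        (.index hv'.learn.push.1) hq.push)

section Input

open Det

protected theorem Comp.nS : C.Comp fun γ => nS (C.inp γ) := .input (.const 0)

protected theorem Comp.nL : C.Comp fun γ => nL (C.inp γ) := .input (.const 1)

protected theorem Comp.thr : C.Comp fun γ => thr (C.inp γ) := .input (.const 2)

protected theorem Comp.ini : C.Comp fun γ => ini (C.inp γ) := .input (.const 3)

protected theorem PolyBounded.nS : C.PolyBounded fun γ => nS (C.inp γ) :=
  PolyBounded.size.mono fun γ => C.inp_le γ _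

protected theorem PolyBounded.thr : C.PolyBounded fun γ => thr (C.inp γ) :=
  PolyBounded.size.mono fun γ => C.inp_le γ _

protected theorem PolyBounded.ini : C.PolyBounded fun γ => ini (C.inp γ) :=
  PolyBounded.size.mono fun γ => C.inp_le γ _

protected theorem Comp.nV : C.Comp fun γ => (sys (C.inp γ)).v := Comp.nS.add (.const 1)

protected theorem PolyBounded.nV : C.PolyBounded fun γ => (sys (C.inp γ)).v := PolyBounded.nS.add (.const 1)

protected theorem Comp.nPairs : C.Comp fun γ => nPairs (C.inp γ) := Comp.nV.mul .nV

protected theorem PolyBounded.nPairs : C.PolyBounded fun γ => nPairs (C.inp γ) := PolyBounded.nV.mul .nV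

protected theorem Comp.period : C.Comp fun γ => period (C.inp γ) := Comp.nPairs.factorial .nPairs

protected theorem Comp.bigThr : C.Comp fun γ => bigThr (C.inp γ) :=
  Comp.thr.add ((Comp.const 2).mul (Comp.nPairs.mul .nPairs))

protected theorem PolyBounded.bigThr : C.PolyBounded fun γ => bigThr (C.inp γ) :=
  PolyBounded.thr.add ((PolyBounded.const 2).mul (PolyBounded.nPairs.mul .nPairs))

theorem Comp.twoPow : C.Comp fun γ => 2 ^ nS (C.inp γ) := Comp.nS.two_pow .nS

protected theorem Comp.nStates : C.Comp fun γ => nStates (C.inp γ) :=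
  ((Comp.const 4).mul .period).mul .twoPow

variable {p k σ q x y S ρ mode : C.Γ → ℕ}

protected theorem Comp.repr (hk : C.Comp k) (hρ : C.Comp ρ) :
    C.Comp fun γ => repr (C.inp γ) (k γ) (ρ γ) :=
  .ite (.lt hk .bigThr) hk ((Comp.bigThr.mul .period).add hρ)

protected theorem Comp.pack (hm : C.Comp mode) (hρ : C.Comp ρ) (hS : C.Comp S) :
    C.Comp fun γ => pack (C.inp γ) (mode γ) (ρ γ) (S γ) :=
  (((hm.mul .period).add hρ).mul .twoPow).add hS

theorem Dec.isFinal (hq : C.Comp q) : C.Dec fun γ => IsFinal (C.inp γ) (q γ) :=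
  .ne_zero (.input ((Comp.const 4).add hq))

theorem Dec.hasTrans (hp : C.Comp p) (hk : C.Comp k) (hσ : C.Comp σ) (hq : C.Comp q) :
    C.Dec fun γ => HasTrans (C.inp γ) (p γ) (k γ) (σ γ) (q γ) :=
  .ne_zero (.input (((Comp.const 4).add .nS).add
    (((((((hp.mul (Comp.thr.add (.const 1))).add hk).mul (Comp.nL.add (.const 2))).add
      hσ).mul .nS)).add hq)))

theorem Dec.up (hx : C.Comp x) (hp : C.Comp p) (hq : C.Comp q) :
    C.Dec fun γ => (sys (C.inp γ)).up (x γ) (p γ) (q γ) :=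
  ((Dec.lt hp .nS).and ((Dec.lt hq .nS).and (.hasTrans hp (hx.min .thr) .nL hq))).or
    (((Dec.eq hp .nS).or ((Dec.lt hp .nS).and (.isFinal hp))).and (.eq hq .nS))

theorem Dec.dn (hx : C.Comp x) (hp : C.Comp p) (hq : C.Comp q) :
    C.Dec fun γ => (sys (C.inp γ)).dn (x γ) (p γ) (q γ) :=
  ((Dec.lt hp .nS).and ((Dec.lt hq .nS).and
    (.hasTrans hp ((hx.add (.const 1)).min .thr) (Comp.nL.add (.const 1)) hq))).or
    ((Dec.eq hp .nS).and (.eq hq .nS))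

theorem Comp.peak (hx : C.Comp x) :
    C.Comp fun γ => relCode (sys (C.inp γ)).v ((sys (C.inp γ)).peak (x γ)) := by
  have hh : C.Comp fun γ => (sys (C.inp γ)).height := (Comp.nV.mul .nV).add .thr
  -- The level falls from `x + height` to `x` while the height grows: `above (j + 1)` at one level
  -- needs only `above j` at the next higher level, so a single code has to be stored.
  refine (Comp.loop (acc := fun γ j => relCode (sys (C.inp γ)).v
    ((sys (C.inp γ)).above j (x γ + (sys (C.inp γ)).height - j))) hh ?_ (.relCode (PolyBounded.nV.push))
    fun h => ?_).congr fun γ => ?_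
  · exact (Comp.relCode_of (r := fun _ p q => p = q) .nV .nV fun p q hp hq => .eq hp hq).congr
      fun γ => relCode_congr fun p hp q _ => by simp [CounterSystem.above, hp]
  · let D := (C.push fun γ => (sys (C.inp γ)).height).learn fun y =>
      relCode (sys (C.inp y.1)).v
        ((sys (C.inp y.1)).above y.2 (x y.1 + (sys (C.inp y.1)).height - y.2))
    have hz : D.Comp fun y => x y.1 + (sys (C.inp y.1)).height - (y.2 + 1) :=
      ((hx.add hh).push.sub ((Comp.index hh.1).add (.const 1))).learn
    have hv : D.Comp fun y => (sys (C.inp y.1)).v := Comp.nV (C := D)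
    have hb : D.PolyBounded fun y => (sys (C.inp y.1)).v := PolyBounded.nV (C := D)
    have h' : D.Comp fun y => relCode (sys (C.inp y.1)).v ((sys (C.inp y.1)).above y.2
        (x y.1 + (sys (C.inp y.1)).height - (y.2 + 1) + 1)) :=
      Comp.congr h fun y => by
        have h1 : (y.2 : ℕ) < (sys (C.inp y.1)).height := y.2.2
        rw [show x y.1 + (sys (C.inp y.1)).height - (y.2 + 1) + 1 =
          x y.1 + (sys (C.inp y.1)).height - y.2 by omega]
    refine Comp.congr ?_ fun y => (CounterSystem.relCode_above_succ _ _ _).symm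
    refine Comp.closure hv hb (Comp.relCode_of hv hb fun p q hp hq => ?_)
    refine .exists_lt hv.push (.exists_lt hv.push.push ?_)
    exact (Dec.up hz.push.push.push hp.push.push (Comp.index hv.push.1).push).and
      ((Dec.relOf hv.push.push.push hb.push.push.push h'.push.push.push (Comp.index hv.push.1).push (Comp.index hv.push.push.1)).and
        (Dec.dn hz.push.push.push (Comp.index hv.push.push.1) hq.push.push))
  · rw [Nat.add_sub_cancel]
    rfl

/-- The number of rounds is `x`, which may be exponential, as it is for the representatives above
`bigThr`. -/
theorem Comp.loops (hx : C.Comp x) :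
    C.Comp fun γ => relCode (sys (C.inp γ)).v ((sys (C.inp γ)).loops (x γ)) := by
  refine Comp.loop (acc := fun γ i => relCode (sys (C.inp γ)).v ((sys (C.inp γ)).loops i)) hx
    (Comp.peak (.const 0)) (.relCode (PolyBounded.nV.push)) fun h => ?_
  let D := (C.push x).learn fun y => relCode (sys (C.inp y.1)).v ((sys (C.inp y.1)).loops y.2)
  have hi : D.Comp fun y => (y.2 : ℕ) := (Comp.index hx.1).learn
  have hv : D.Comp fun y => (sys (C.inp y.1)).v := Comp.nV (C := D)
  have hb : D.PolyBounded fun y => (sys (C.inp y.1)).v := PolyBounded.nV (C := D)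
  have hk : D.Comp fun y => relCode (sys (C.inp y.1)).v ((sys (C.inp y.1)).peak (y.2 + 1)) :=
    Comp.peak (C := D) (hi.add (.const 1))
  refine Comp.congr ?_ fun y => (CounterSystem.relCode_loops_succ _ _).symm
  refine Comp.relCode_of hv hb fun p q hp hq => ?_
  refine (Dec.relOf hv.push hb.push hk.push hp hq).or
    (.exists_lt hv.push (.exists_lt hv.push.push ?_))
  refine .and (.exists_lt hv.push.push.push ?_) (.and (.exists_lt hv.push.push.push ?_) ?_)
  · exact (Dec.relOf hv.push.push.push.push hb.push.push.push.push hk.push.push.push.push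
      hp.push.push.push (Comp.index hv.push.push.push.1)).and (Dec.dn hi.push.push.push.push (Comp.index hv.push.push.push.1) (Comp.index hv.push.1).push.push)
  · exact (Dec.up hi.push.push.push.push (Comp.index hv.push.push.1).push (Comp.index hv.push.push.push.1)).and
      (Dec.relOf hv.push.push.push.push hb.push.push.push.push hk.push.push.push.push
        (Comp.index hv.push.push.push.1) hq.push.push.push)
  · exact Dec.relOf hv.push.push.push hb.push.push.push h.push.push.push (Comp.index hv.push.1).push (Comp.index hv.push.push.1)

theorem Dec.loops (hx : C.Comp x) (hp : C.Comp p) (hq : C.Comp q) :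
    C.Dec fun γ => (sys (C.inp γ)).loops (x γ) (p γ) (q γ) :=
  (Dec.relOf .nV .nV (Comp.loops hx) hp hq).congr fun γ => by
    rw [relOf_relCode]
    exact ⟨fun h => h.2.2, fun h => ⟨(CounterSystem.loops_lt h).1, (CounterSystem.loops_lt h).2, h⟩⟩

theorem Dec.reachable (hS : C.Comp S) (hx : C.Comp x) (hq : C.Comp q) :
    C.Dec fun γ => Reachable (C.inp γ) (S γ) (x γ) (q γ) :=
  .exists_lt .nS <|
    (Dec.testBit hS.push (.index Comp.nS.1) (PolyBounded.nS.push.mono fun y => y.2.2.le)).and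
      (Dec.loops hx.push (.index Comp.nS.1) hq.push)

protected theorem Comp.nextSet {t : C.Γ → ℕ → ℕ → Prop} (hS : C.Comp S) (hx : C.Comp x)
    (ht : ∀ p q : ((C.push fun γ => nS (C.inp γ)).push fun y => nS (C.inp y.1)).Γ → ℕ,
      Ctx.Comp _ p → Ctx.Comp _ q →
      Ctx.Dec ((C.push fun γ => nS (C.inp γ)).push fun y => nS (C.inp y.1))
        fun y => t y.1.1 (p y) (q y)) :
    C.Comp fun γ => nextSet (C.inp γ) (S γ) (x γ) (t γ) := by
  have h1 : (C.push fun γ => nS (C.inp γ)).Comp fun y => nS (C.inp y.1) := Comp.nS.push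
  have h2 := Comp.index h1.1
  exact .setCode .nS .nS <| .exists_lt h1 <| (Dec.reachable hS.push.push hx.push.push h2).and
    (ht _ _ h2 (Comp.index Comp.nS.1).push)

protected theorem Comp.letterState (hρ : C.Comp ρ) (hS : C.Comp S) (hx : C.Comp x) :
    C.Comp fun γ => letterState (C.inp γ) (ρ γ) (S γ) (x γ) := by
  classical
  exact .pack ((Comp.ite (.reachable hS hx .nS) (.const 3) (.const 0)).congr fun γ => by
    rw [letterMode]) hρ hS

protected theorem Comp.start : C.Comp fun γ => start (C.inp γ) :=
  .letterState (.const 0) (Comp.ini.two_pow .ini) (.const 0)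

protected theorem Comp.next (hm : C.Comp mode) (hρ : C.Comp ρ) (hS : C.Comp S) (hx : C.Comp x)
    (hσ : C.Comp σ) : C.Comp fun γ => next (C.inp γ) (mode γ) (ρ γ) (S γ) (x γ) (σ γ) := by
  refine .ite (.lt hσ .nL) (.letterState hρ (.nextSet hS hx fun p q hp hq => ?_) hx)
    (.ite (.eq hσ .nL)
      (.pack (.const 1) ((hρ.add (.const 1)).mod .period)
        (.ite (.eq hm (.const 2)) (.const 0) (.nextSet hS hx fun p q hp hq => ?_)))
      (.pack (.const 2) ((hρ.add (Comp.period.sub (.const 1))).mod .period)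
        (.ite (.eq hm (.const 1)) (.const 0) (.nextSet hS hx fun p q hp hq => ?_))))
  · exact Dec.hasTrans hp (hx.push.push.min .thr) hσ.push.push hq
  · exact Dec.up hx.push.push hp hq
  · exact Dec.dn (hx.push.push.sub (.const 1)) hp hq

protected theorem Comp.delta (hp : C.Comp p) (hk : C.Comp k) (hσ : C.Comp σ) :
    C.Comp fun γ => delta (C.inp γ) (p γ) (k γ) (σ γ) :=
  have h := hp.div .twoPow
  .next (h.div .period) (h.mod .period) (hp.mod .twoPow) (.repr hk (h.mod .period)) hσ

/-- The encoding of the determinized automaton. -/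
noncomputable def _root_.Det.detCode (w : List ℕ) : List ℕ :=
  [Det.nStates w] ++ [Det.nL w] ++ [Det.bigThr w] ++ [Det.start w] ++
    ((List.finRange (Det.nStates w)).flatMap fun q : Fin (Det.nStates w) =>
      [if (q : ℕ) / 2 ^ Det.nS w / Det.period w = 3 then 1 else 0]) ++
    (List.finRange (Det.nStates w)).flatMap fun p : Fin (Det.nStates w) =>
      (List.finRange (Det.bigThr w + 1)).flatMap fun k : Fin (Det.bigThr w + 1) =>
        (List.finRange (Det.nL w + 2)).flatMap fun σ : Fin (Det.nL w + 2) =>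
          (List.finRange (Det.nStates w)).flatMap fun q : Fin (Det.nStates w) =>
            [if (q : ℕ) = Det.delta w p k σ then 1 else 0]

protected theorem Writes.detCode : C.Writes fun γ => detCode (C.inp γ) := by
  refine .append (.append (.append (.append (.append (Comp.write .nStates) (Comp.write .nL))
    (Comp.write .bigThr)) (Comp.write .start)) ?_) ?_
  · exact .flatMap_finRange .nStates (Comp.write (.ite (.eq (((Comp.index Comp.nStates.1).div
      .twoPow).div .period) (.const 3)) (.const 1) (.const 0)))
  · have h1 := Comp.nStates (C := C)
    have h2 := (Comp.bigThr (C := C)).add (.const 1)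
    have h3 := (Comp.nL (C := C)).add (.const 2)
    exact .flatMap_finRange h1 <| .flatMap_finRange h2.push <| .flatMap_finRange h3.push.push <|
      .flatMap_finRange h1.push.push.push <| Comp.write <| .ite
        (.eq (.index h1.push.push.push.1) (.delta (Comp.index h1.1).push.push.push
          (Comp.index h2.push.1).push.push (Comp.index h3.push.push.1).push))
        (.const 1) (.const 0)

end Input

end RAM.Ctx

/-! ### The encoded output and the main theorem -/

namespace Det

theorem exists_lab_eq {α : Type*} {s : ℕ} (eα : α ≃ Fin s) {i : ℕ} (hi : i < s + 2) :
    ∃ σ, lab eα σ = i := by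
  rcases lt_trichotomy i s with h | rfl | h
  · exact ⟨.inl (eα.symm ⟨i, h⟩), by simp [lab]⟩
  · exact ⟨.inr .inc, rfl⟩
  · exact ⟨.inr .dec, by simp only [lab]; omega⟩

theorem flatMap_labelList {α : Type*} {s : ℕ} (eα : α ≃ Fin s) (f : ℕ → List ℕ) :
    ((labelList eα).flatMap fun σ => f (lab eα σ)) =
      (List.finRange (s + 2)).flatMap fun σ : Fin (s + 2) => f σ := by
  have h : (labelList eα).map (lab eα) = (List.finRange (s + 2)).map fun σ : Fin (s + 2) => (σ : ℕ) := by
    refine List.ext_getElem (by simp [length_labelList]) fun i h1 h2 => ?_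
    obtain ⟨σ, rfl⟩ := exists_lab_eq eα (i := i) (by simpa [length_labelList] using h1)
    simp [labelList_getElem]
  have h' := congrArg (List.flatMap f) h
  simpa only [List.flatMap_map] using h'

theorem encode_det {α : Type*} {s : ℕ} {w : List ℕ} (eα : α ≃ Fin s) (hi : ini w < nS w)
    (hs : nL w = s) :
    (det eα hi).encode (Equiv.refl (Fin (nStates w))) eα = detCode w := by
  have h1 : (det eα hi).threshold = bigThr w := rfl
  have h2 : ((det eα hi).init : ℕ) = start w := rfl
  have h3 (p q : Fin (nStates w)) (k : Fin ((det eα hi).threshold + 1)) (σ : α ⊕ CounterOp) :=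
    mem_det_trans (eα := eα) (hi := hi) (p := p) (q := q) (k := k) (σ := σ)
  have h4 (q : Fin (nStates w)) := mem_det_final (eα := eα) (hi := hi) (q := q)
  rw [OCA.encode, detCode, hs]
  simp only [Equiv.refl_apply, Equiv.refl_symm, h2, h3, h4, List.singleton_append,
    List.map_eq_flatMap]
  refine congrArg₂ _ rfl (congrArg₂ _ ?_ rfl)
  funext p
  refine congrArg₂ _ ?_ rfl
  funext k
  exact (flatMap_labelList eα fun σ => (List.finRange (nStates w)).flatMap fun q : Fin (nStates w) =>
    [if (q : ℕ) = delta w p k σ then 1 else 0])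

end Det

/-- The context of all lists, with bounds of their entries. -/
def RAM.Ctx.inputs : RAM.Ctx where
  Γ := {z : List ℕ × ℕ // ∀ i, z.1.getD i 0 ≤ z.2}
  inp z := z.1.1
  sz z := z.1.2
  known := ∅
  inp_le z := z.2

theorem mainTheorem1 :
    ∃ (P : RAM.Prog) (p r : Polynomial ℕ),
      ∀ (Q α : Type*) [Fintype Q] [Fintype α] [Nonempty α] (n s : ℕ)
        (eQ : Q ≃ Fin n) (eα : α ≃ Fin s) (A : OCA Q α),
        ∃ (n' : ℕ) (A' : OCA (Fin n') α),
          P.OutputsWithin (A.encode eQ eα) (A'.encode (Equiv.refl (Fin n')) eα)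
            (2 ^ p.eval A.size) ∧
          A'.threshold ≤ r.eval A.size ∧
          A'.Lobs = A.Lobs ∧
          A'.IsDeterministic ∧
          A'.Lvis ≤ Encs α := by
  obtain ⟨r, hr⟩ := RAM.Ctx.PolyBounded.bigThr (C := RAM.Ctx.inputs)
  obtain ⟨P, T, ⟨p, hp⟩, hP⟩ :=
    (RAM.Ctx.Writes.detCode (C := RAM.Ctx.inputs)).2 (fun _ => 0) 0 fun _ he => he.elim
  refine ⟨P, p, r, fun Q α _ _ _ n s eQ eα A => ?_⟩
  let γ : RAM.Ctx.inputs.Γ := ⟨(A.encode eQ eα, A.size), Det.getD_encode_le A eQ eα⟩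
  have hw := Det.codes_encode A eQ eα
  have hi := Det.ini_lt hw
  obtain ⟨t, M, hE, ht, -, -⟩ := hP γ (fun _ => 0) [] fun _ he => he.elim
  refine ⟨_, Det.det eα hi, ⟨t, M, ht.trans (hp γ), ?_⟩, hr γ, ?_, Det.det_isDeterministic,
    Det.det_Lvis hw.nL_eq⟩
  · rw [Det.encode_det eα hi hw.nL_eq]
    exact hE
  · rw [Det.det_Lobs hw.nL_eq, Det.Lobs_eq hw]
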